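/- Let $(X,d,\mu)$ be a metric measure space, i.e. $(X,d)$ is a metric space and $\mu$ is a Borel measure on $X$ with $0<\mu(B(x,r))<\infty$ for all $x\in X$, $r\in(0,\infty)$, where $B(x,r)=\{y: d(x,y)<r\}$. **Exponents.** $\mathcal P(X)$ is the set of measurable $p:X\to(0,\infty]$ with $p^-:=\operatorname{ess\,inf}_X p>0$, and $\mathcal P_b(X)$ is the set of $p\in\mathcal P(X)$ with $p^+:=\operatorname{ess\,sup}_X p<\infty$. We write $p\in\mathcal P^{\log}_\mu(X)$ if $p\in\mathcal P_b(X)$, there is a constant $C<\infty$ with $\mu(B)^{1/p_B^+-1/p_B^-}\le C$ for every ball $B\subseteq X$ (where $p_B^+=\operatorname{ess\,sup}_B p$, $p_B^-=\operatorname{ess\,inf}_B p$), and there is $p_\infty\in(0,\infty]$ such that $1\in L^{t(\cdot)}(X,\mu)$, where $\frac1{t(x)}=\left|\frac1{p(x)}-\frac1{p_\infty}\right|$. The measure $\mu$ is integrable if $\int_X \frac{1}{\mu(B(x,r))}\,d\mu(x)<\infty$ for every $r\in(0,\infty)$. **Lebesgue spaces.** For $p\in\mathcal P(X)$ put $\rho_{p(\cdot)}(u)=\int_X\varphi_{p(x)}(|u(x)|)\,d\mu(x)$,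 where $\varphi_p(t)=t^p$ for $p<\infty$, $\varphi_\infty(t)=0$ for $t\le1$ and $\varphi_\infty(t)=\infty$ for $t>1$. $L^{p(\cdot)}(X,\mu)$ consists of the measurable $u$ with $\rho_{p(\cdot)}(\lambda u)<\infty$ for some $\lambda\in(0,\infty)$, with quasi-norm $\|u\|_{L^{p(\cdot)}}=\inf\{\lambda\in(0,\infty):\rho_{p(\cdot)}(u/\lambda)\le1\}$. **Sequence spaces.** For $p\in\mathcal P_b(X)$, $q\in\mathcal P(X)$ and a sequence $g=\{g_k\}_{k\in\mathbb Z}$ of measurable functions, let $\|g\|_{L^{p(\cdot)}(\ell^{q(\cdot)})}$ be the $L^{p(\cdot)}$ quasi-norm of $x\mapsto\|\{g_k(x)\}_k\|_{\ell^{q(x)}}$, and let $$\|g\|_{\ell^{q(\cdot)}(L^{p(\cdot)})}=\inf\Big\{\tau\in(0,\infty):\ \sum_{k\in\mathbb Z}\inf\big\{\lambda\in(0,\infty):\rho_{p(\cdot)}\big(g_k/(\tau\lambda^{1/q(\cdot)})\big)\le1\big\}\le1\Big\},$$ with $\lambda^{1/\infty}=1$ and $\inf\emptyset=\infty$. **Hajłasz-type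 spaces.** Let $s,p\in\mathcal P_b(X)$, $q\in\mathcal P(X)$. For a measurable, a.e. finite function $u$, $\mathbb D^{s(\cdot)}(u)$ is the set of sequences $\{g_k\}_{k\in\mathbb Z}$ of non-negative measurable functions for which there is a $\mu$-null set $N$ with $$|u(x)-u(y)|\le d(x,y)^{s(x)}g_k(x)+d(x,y)^{s(y)}g_k(y)$$ for all $k\in\mathbb Z$ and $x,y\in X\setminus N$ with $2^{-k-1}\le d(x,y)<2^{-k}$. The Hajłasz–Triebel–Lizorkin space $M^{s(\cdot)}_{p(\cdot),q(\cdot)}(X,d,\mu)$ consists of those $u\in L^{p(\cdot)}(X,\mu)$ with finite quasi-norm $\|u\|_{L^{p(\cdot)}}+\inf_{g\in\mathbb D^{s(\cdot)}(u)}\|g\|_{L^{p(\cdot)}(\ell^{q(\cdot)})}$, and the Hajłasz–Besov space $N^{s(\cdot)}_{p(\cdot),q(\cdot)}(X,d,\mu)$ of those $u\in L^{p(\cdot)}(X,\mu)$ with finite quasi-norm $\|u\|_{L^{p(\cdot)}}+\inf_{g\in\mathbb D^{s(\cdot)}(u)}\|g\|_{\ell^{q(\cdot)}(L^{p(\cdot)})}$.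 **Theorem.** Let $p,s\in\mathcal P_b(X)$ and $q\in\mathcal P(X)$. Assume that at least one of the following holds: (i) $(X,d)$ is totally bounded; (ii) $\mu$ is integrable and $p\in\mathcal P^{\log}_\mu(X)$. Then the embeddings $$M^{s(\cdot)}_{p(\cdot),q(\cdot)}(X,d,\mu)\hookrightarrow\hookrightarrow L^{p(\cdot)}(X,\mu),\qquad N^{s(\cdot)}_{p(\cdot),q(\cdot)}(X,d,\mu)\hookrightarrow\hookrightarrow L^{p(\cdot)}(X,\mu)$$ are compact, i.e. each of the two spaces is continuously included in $L^{p(\cdot)}(X,\mu)$ and every sequence bounded in it has a subsequence that converges in $L^{p(\cdot)}(X,\mu)$. -/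

import Mathlib

open Set Filter Topology MeasureTheory
open scoped NNReal ENNReal

noncomputable section

namespace VarExp

/-! ### Variable exponents -/

section Exponents

variable {X : Type*} [MeasurableSpace X]

/-- `p ∈ 𝒫(X)`: a measurable function `p : X → (0, ∞]` with `p⁻ = ess inf p > 0`. -/
structure IsExponent (p : X → ℝ≥0∞) (μ : Measure X) : Prop where
  measurable : Measurable p
  pos : ∀ x, 0 < p x
  essInf_pos : 0 < essInf p μ

/-- `p ∈ 𝒫_b(X) = 𝒫(X) ∩ L^∞(X, μ)`. -/
structure IsBoundedExponent (p : X → ℝ≥0∞) (μ : Measure X) : Prop extends IsExponent p μ where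
  essSup_lt_top : essSup p μ < ∞

end Exponents

/-! ### Variable exponent Lebesgue spaces

Moduli of functions take values in `[0, ∞]`; a real-valued function `u` enters through
`x ↦ ‖u x‖ₑ = |u x|`. Functions are not passed to the quotient by equality almost everywhere:
all quantities below are invariant under changes on null sets. -/

section Lebesgue

variable {X : Type*} [MeasurableSpace X]

/-- `φ_p(t) = t ^ p` for `p < ∞`, while `φ_∞` is `0` on `[0, 1]` and `∞` on `(1, ∞]`. -/
def phi (p t : ℝ≥0∞) : ℝ≥0∞ :=
  if p = ∞ then (if t ≤ 1 then 0 else ∞) else t ^ p.toReal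

/-- The semi-modular `ρ_{p(·)}(f) = ∫ φ_{p(x)}(f(x)) dμ(x)`. -/
def modular (p : X → ℝ≥0∞) (μ : Measure X) (f : X → ℝ≥0∞) : ℝ≥0∞ :=
  ∫⁻ x, phi (p x) (f x) ∂μ

/-- The Luxemburg quasi-norm `inf {c ∈ (0, ∞) : ρ_{p(·)}(f / c) ≤ 1}`, equal to `∞` when
there is no such `c`. -/
def lpNormE (p : X → ℝ≥0∞) (μ : Measure X) (f : X → ℝ≥0∞) : ℝ≥0∞ :=
  sInf {c : ℝ≥0∞ | 0 < c ∧ c < ∞ ∧ modular p μ (fun x => f x / c) ≤ 1}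

/-- `‖u‖_{L^{p(·)}(X, μ)}` for a real function `u`. -/
def lpNorm (p : X → ℝ≥0∞) (μ : Measure X) (u : X → ℝ) : ℝ≥0∞ :=
  lpNormE p μ (fun x => ‖u x‖ₑ)

/-- The space `L^{p(·)}(X, μ)`: (a.e.) measurable `u` such that `ρ_{p(·)}(c u) < ∞`
for some `c ∈ (0, ∞)`. -/
def LpSpace (p : X → ℝ≥0∞) (μ : Measure X) : Set (X → ℝ) :=
  {u | AEMeasurable u μ ∧
    ∃ c : ℝ≥0∞, 0 < c ∧ c < ∞ ∧ modular p μ (fun x => c * ‖u x‖ₑ) < ∞}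

/-! ### Mixed Lebesgue sequence spaces -/

/-- The `ℓ^q` quasi-norm, `q ∈ (0, ∞]`, of a sequence indexed by `ℤ` with values in `[0, ∞]`. -/
def ellNorm (q : ℝ≥0∞) (a : ℤ → ℝ≥0∞) : ℝ≥0∞ :=
  if q = ∞ then ⨆ k, a k else (∑' k, a k ^ q.toReal) ^ (1 / q.toReal)

/-- The quasi-norm of `L^{p(·)}(ℓ^{q(·)}(X, μ))`. -/
def lpEllNorm (p q : X → ℝ≥0∞) (μ : Measure X) (g : ℤ → X → ℝ≥0∞) : ℝ≥0∞ :=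
  lpNormE p μ (fun x => ellNorm (q x) (fun k => g k x))

/-- The semi-modular of `ℓ^{q(·)}(L^{p(·)}(X, μ))`,
`∑_k inf {l ∈ (0, ∞) : ρ_{p(·)}(g_k / l ^ (1 / q(·))) ≤ 1}`, where `l ^ (1 / ∞) = 1`. -/
def ellLpModular (p q : X → ℝ≥0∞) (μ : Measure X) (g : ℤ → X → ℝ≥0∞) : ℝ≥0∞ :=
  ∑' k, sInf {l : ℝ≥0∞ | 0 < l ∧ l < ∞ ∧
    modular p μ (fun x => g k x / l ^ ((q x)⁻¹).toReal) ≤ 1}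

/-- The quasi-norm of `ℓ^{q(·)}(L^{p(·)}(X, μ))`. -/
def ellLpNorm (p q : X → ℝ≥0∞) (μ : Measure X) (g : ℤ → X → ℝ≥0∞) : ℝ≥0∞ :=
  sInf {c : ℝ≥0∞ | 0 < c ∧ c < ∞ ∧ ellLpModular p q μ (fun k x => g k x / c) ≤ 1}

end Lebesgue

/-! ### Metric measure spaces and Hajłasz type spaces -/

section Metric

variable {X : Type*} [MetricSpace X] [MeasurableSpace X]

/-- Every open ball has positive and finite measure. -/
def BallsPosFinite (μ : Measure X) : Prop :=
  ∀ (x : X) (r : ℝ), 0 < r → 0 < μ (Metric.ball x r) ∧ μ (Metric.ball x r) < ∞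

/-- `μ` is integrable: `∫ 1 / μ(B(x, r)) dμ(x) < ∞` for every `r ∈ (0, ∞)`. -/
def IsIntegrableMeasure (μ : Measure X) : Prop :=
  ∀ r : ℝ, 0 < r → ∫⁻ x, (μ (Metric.ball x r))⁻¹ ∂μ < ∞

/-- `p ∈ 𝒫_μ^log(X)`: `p ∈ 𝒫_b(X)`, the numbers `μ(B) ^ (1 / p_B⁺ - 1 / p_B⁻)` are bounded
over all balls `B`, and for some `p_∞ ∈ (0, ∞]` the constant function `1` belongs to
`L^{t(·)}(X, μ)`, where `1 / t(x) = |1 / p(x) - 1 / p_∞|` (with `1 / ∞ = 0`, `1 / 0 = ∞`). -/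
structure IsLogExponent (p : X → ℝ≥0∞) (μ : Measure X) : Prop extends
    IsBoundedExponent p μ where
  ball_bound : ∃ C : ℝ≥0∞, C < ∞ ∧ ∀ (x : X) (r : ℝ), 0 < r →
    μ (Metric.ball x r) ^
      (((essSup p (μ.restrict (Metric.ball x r)))⁻¹).toReal -
        ((essInf p (μ.restrict (Metric.ball x r)))⁻¹).toReal) ≤ C
  decay : ∃ pinf : ℝ≥0∞, 0 < pinf ∧
    (fun _ : X => (1 : ℝ)) ∈
      LpSpace (fun x => (ENNReal.ofReal |((p x)⁻¹).toReal - (pinf⁻¹).toReal|)⁻¹) μ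

/-- `𝔻^{s(·)}(u)`: sequences `(g_k)_{k ∈ ℤ}` of non-negative (a.e.) measurable functions
such that, for some null set `N`,
`|u(x) - u(y)| ≤ d(x, y) ^ s(x) g_k(x) + d(x, y) ^ s(y) g_k(y)` whenever `x, y ∉ N` and
`2 ^ (-k - 1) ≤ d(x, y) < 2 ^ (-k)`. -/
def vectorGradients (s : X → ℝ≥0∞) (μ : Measure X) (u : X → ℝ) : Set (ℤ → X → ℝ≥0∞) :=
  {g | (∀ k, AEMeasurable (g k) μ) ∧ ∃ N : Set X, μ N = 0 ∧
    ∀ (k : ℤ) (x y : X), x ∉ N → y ∉ N →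
      (2 : ℝ) ^ (-k - 1) ≤ dist x y → dist x y < (2 : ℝ) ^ (-k) →
      ENNReal.ofReal |u x - u y| ≤
        ENNReal.ofReal (dist x y ^ (s x).toReal) * g k x +
          ENNReal.ofReal (dist x y ^ (s y).toReal) * g k y}

/-- The homogeneous Hajłasz-Triebel-Lizorkin quasi-semi-norm (the infimum of the empty set
is `∞`). -/
def tlSeminorm (s p q : X → ℝ≥0∞) (μ : Measure X) (u : X → ℝ) : ℝ≥0∞ :=
  ⨅ g ∈ vectorGradients s μ u, lpEllNorm p q μ g

/-- The homogeneous Hajłasz-Besov quasi-semi-norm. -/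
def besovSeminorm (s p q : X → ℝ≥0∞) (μ : Measure X) (u : X → ℝ) : ℝ≥0∞ :=
  ⨅ g ∈ vectorGradients s μ u, ellLpNorm p q μ g

/-- The Hajłasz-Triebel-Lizorkin space `M^{s(·)}_{p(·),q(·)}(X, d, μ)`. -/
def TLSpace (s p q : X → ℝ≥0∞) (μ : Measure X) : Set (X → ℝ) :=
  {u | u ∈ LpSpace p μ ∧ tlSeminorm s p q μ u < ∞}

/-- The quasi-norm of `M^{s(·)}_{p(·),q(·)}(X, d, μ)`. -/
def tlNorm (s p q : X → ℝ≥0∞) (μ : Measure X) (u : X → ℝ) : ℝ≥0∞ :=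
  lpNorm p μ u + tlSeminorm s p q μ u

/-- The Hajłasz-Besov space `N^{s(·)}_{p(·),q(·)}(X, d, μ)`. -/
def BesovSpace (s p q : X → ℝ≥0∞) (μ : Measure X) : Set (X → ℝ) :=
  {u | u ∈ LpSpace p μ ∧ besovSeminorm s p q μ u < ∞}

/-- The quasi-norm of `N^{s(·)}_{p(·),q(·)}(X, d, μ)`. -/
def besovNorm (s p q : X → ℝ≥0∞) (μ : Measure X) (u : X → ℝ) : ℝ≥0∞ :=
  lpNorm p μ u + besovSeminorm s p q μ u

end Metric

/-- The compact embedding `A ↪↪ B` of function spaces `A`, `B` with quasi-norms `nA`, `nB`: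
`A ⊆ B`, the inclusion is bounded, and every sequence bounded in `A` has a subsequence
converging in `B` to an element of `B`. -/
def CompactlyEmbedded {X : Type*} (A : Set (X → ℝ)) (nA : (X → ℝ) → ℝ≥0∞)
    (B : Set (X → ℝ)) (nB : (X → ℝ) → ℝ≥0∞) : Prop :=
  A ⊆ B ∧ (∃ C : ℝ≥0, ∀ u ∈ A, nB u ≤ C * nA u) ∧
    ∀ u : ℕ → X → ℝ, (∀ n, u n ∈ A) → (∃ C : ℝ≥0, ∀ n, nA (u n) ≤ C) →
      ∃ v ∈ B, ∃ i : ℕ → ℕ, StrictMono i ∧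
        Tendsto (fun n => nB (fun x => u (i n) x - v x)) atTop (𝓝 0)

end VarExp

end

namespace VarExp

/-! ### Powers with variable exponent -/

section Powers

/-! Boundedness in either space enters only through `GradientBound`: every entry of suitable vector
gradients has modular at most a common constant. The exponent `q` plays no further role, and both
embeddings follow from one compactness argument.

Smoothness gives small increments. At distances below `2^(-m)` the gradients carry weights `2^(-j
s(x))` with `j ≥ m`. Since `s` and `p` are bounded below, their modulars decay geometrically, so one
function `G` of small modular satisfies `|u_n(x) - u_n(y)| ≤ G(x) + G(y)`
(`GradientBound.smallIncrements`).

Almost everywhere convergence comes from a Kolmogorov-type argument for the bounded functions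
`arctan u_n` in `L¹` of a finite measure equivalent to `μ`: they are close to their averages over
small cells, and the averages converge along a diagonal subsequence. Fatou's lemma keeps the limit
of the arctangents away from `±π/2`, so the tangent recovers an a.e. limit of `u_n` itself
(`exists_subseq_tendsto_ae`).

Modular convergence needs a majorant; this is where (i) or (ii) is used. By Chebyshev, a ball `B(x,
r)` contains many `y` at which `|u_n(y)|^p(y)` is at most a constant over `μ(B(x, r))`. Replacing
the exponent `p(y)` by `p(x)` yields an integrable bound `Φ(x)` independent of `n`
(`LocallyDominated`). The small increments carry it from `y` to `x`, and dominated convergence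
applies up to a small error (`tendsto_lintegral_rpow_sub`). As `p` is bounded, modular convergence
is norm convergence. -/

lemma ennreal_add_rpow_le {P b : ℝ} (hP : 0 ≤ P) (hPb : P ≤ b) (x y : ℝ≥0∞) :
    (x + y) ^ P ≤ 2 ^ b * (x ^ P + y ^ P) := by
  have h2 : x + y ≤ 2 * max x y := by
    rw [two_mul]; exact add_le_add (le_max_left _ _) (le_max_right _ _)
  calc (x + y) ^ P ≤ (2 * max x y) ^ P := ENNReal.rpow_le_rpow h2 hP
    _ = 2 ^ P * (max x y) ^ P := ENNReal.mul_rpow_of_nonneg _ _ hP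
    _ ≤ 2 ^ b * (x ^ P + y ^ P) := by
      gcongr
      · norm_num
      · rcases max_choice x y with h | h <;> rw [h]
        · exact le_self_add
        · exact le_add_self

lemma rpow_le_max_one_rpow {P b : ℝ} (hP : 0 ≤ P) (hPb : P ≤ b) (x : ℝ≥0∞) :
    x ^ P ≤ max 1 x ^ b :=
  (ENNReal.rpow_le_rpow (le_max_right 1 x) hP).trans
    (ENNReal.rpow_le_rpow_of_exponent_le (le_max_left 1 x) hPb)

/-- A weak form of Young's inequality. -/
lemma mul_rpow_le_rpow_add {x γ P Q τ : ℝ} (hx : 0 ≤ x) (hγ : 0 < γ) (hP : 0 < P) (hQ : 0 < Q)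
    (hτ : 0 < τ) (h : 1 / P = 1 / τ + 1 / Q) : (γ * x) ^ P ≤ x ^ Q + γ ^ τ := by
  have hPe : P = (τ⁻¹ + Q⁻¹)⁻¹ := by
    rw [← one_div, ← one_div τ, ← one_div Q, ← h, one_div_one_div]
  -- Whichever of the two terms is larger alone dominates the left side, since `P (1 + τ/Q) = τ` and
  -- `P (1 + Q/τ) = Q`.
  rcases le_or_gt (x ^ Q) (γ ^ τ) with h1 | h1
  · have h2 : x ≤ γ ^ (τ / Q) := by
      have := Real.rpow_le_rpow (by positivity) h1 (inv_nonneg.2 hQ.le)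
      rwa [Real.rpow_rpow_inv hx hQ.ne', ← Real.rpow_mul hγ.le] at this
    have h3 : γ * x ≤ γ ^ (1 + τ / Q) := by
      rw [Real.rpow_add hγ, Real.rpow_one]; gcongr
    have h4 : (γ * x) ^ P ≤ γ ^ τ := by
      refine (Real.rpow_le_rpow (by positivity) h3 hP.le).trans_eq ?_
      rw [← Real.rpow_mul hγ.le]
      congr 1
      rw [hPe]; field_simp
    have := Real.rpow_nonneg hx Q
    linarith
  · have hx0 : 0 < x := by
      rcases hx.eq_or_lt with h0 | h0
      · rw [← h0, Real.zero_rpow hQ.ne'] at h1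
        exact absurd h1 (not_lt.2 (Real.rpow_nonneg hγ.le _))
      · exact h0
    have h2 : γ ≤ x ^ (Q / τ) := by
      have := Real.rpow_le_rpow (by positivity) h1.le (inv_nonneg.2 hτ.le)
      rwa [Real.rpow_rpow_inv hγ.le hτ.ne', ← Real.rpow_mul hx] at this
    have h3 : γ * x ≤ x ^ (1 + Q / τ) := by
      rw [Real.rpow_add hx0, Real.rpow_one, mul_comm]; gcongr
    have h4 : (γ * x) ^ P ≤ x ^ Q := by
      refine (Real.rpow_le_rpow (by positivity) h3 hP.le).trans_eq ?_
      rw [← Real.rpow_mul hx]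
      congr 1
      rw [hPe]; field_simp; ring
    have := Real.rpow_nonneg hγ.le τ
    linarith

end Powers

/-! ### The underlying space -/

section Space

variable {X : Type*} [MetricSpace X] [MeasurableSpace X] {μ : Measure X}

lemma BallsPosFinite.sigmaFinite (hμ : BallsPosFinite μ) : SigmaFinite μ := by
  rcases isEmpty_or_nonempty X with h | ⟨⟨x⟩⟩
  · rw [Measure.eq_zero_of_isEmpty μ]; infer_instance
  · refine ⟨⟨⟨fun n => Metric.ball x (n + 1), fun _ => trivial,
      fun n => (hμ x _ (by positivity)).2, ?_⟩⟩⟩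
    refine eq_univ_of_forall fun y => ?_
    obtain ⟨n, hn⟩ := exists_nat_gt (dist y x)
    exact mem_iUnion.2 ⟨n, Metric.mem_ball.2 (by linarith)⟩

/-- A maximal `ε`-separated set is `ε`-dense. The `ε/2`-balls around its points are disjoint and of
positive measure, and a σ-finite measure admits only countably many of these. -/
lemma BallsPosFinite.secondCountableTopology [BorelSpace X] (hμ : BallsPosFinite μ) :
    SecondCountableTopology X := by
  have := hμ.sigmaFinite
  refine Metric.secondCountable_of_almost_dense_set fun ε hε => ?_
  obtain ⟨S, hS⟩ := zorn_subset {S : Set X | S.Pairwise fun x y => ε < dist x y} (by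
    intro c hc hchain
    exact ⟨⋃₀ c, (pairwise_sUnion hchain.directedOn).2 hc, fun s hs => subset_sUnion_of_mem hs⟩)
  refine ⟨S, ?_, fun x => ?_⟩
  · have hd : Pairwise (Function.onFun Disjoint fun x : S => Metric.ball (x : X) (ε / 2)) := by
      intro x y hxy
      refine Metric.ball_disjoint_ball ?_
      have := hS.prop x.2 y.2 (fun h => hxy (Subtype.ext h))
      linarith
    have := Measure.countable_meas_pos_of_disjoint_iUnion (μ := μ)
      (fun x : S => (Metric.isOpen_ball (x := (x : X)) (ε := ε / 2)).measurableSet) hd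
    have h2 : {i : S | 0 < μ (Metric.ball (i : X) (ε / 2))} = univ :=
      eq_univ_of_forall fun i => (hμ i _ (by positivity)).1
    rw [h2, countable_univ_iff] at this
    exact this
  · by_contra! hx
    have hins : insert x S ∈ {S : Set X | S.Pairwise fun x y => ε < dist x y} := by
      refine hS.prop.insert fun y hy _ => ⟨hx y hy, ?_⟩
      rw [dist_comm]; exact hx y hy
    have hxS : x ∈ S := hS.le_of_ge hins (subset_insert _ _) (mem_insert _ _)
    have := hx x hxS
    rw [dist_self] at this
    linarith

lemma measurable_measure_ball [BorelSpace X] [SecondCountableTopology X] [SFinite μ] (r : ℝ) :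
    Measurable fun x => μ (Metric.ball x r) := by
  have : MeasurableSet {z : X × X | dist z.2 z.1 < r} :=
    measurableSet_lt (measurable_snd.dist measurable_fst) measurable_const
  exact measurable_measure_prodMk_left this

/-- The ball moves with `x`, so the defining null sets cannot simply be united. For each rational
level `c` separating the two sides the exceptional set is locally null, hence null by second
countability. This allows `p(x)` at the centre to be compared with `p_B⁺`. -/
lemma ae_le_essSup_ball [SecondCountableTopology X] (p : X → ℝ≥0∞) {r : ℝ}
    (hr : 0 < r) : ∀ᵐ x ∂μ, p x ≤ essSup p (μ.restrict (Metric.ball x r)) := by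
  have key : ∀ c : ℚ, μ {x | essSup p (μ.restrict (Metric.ball x r)) < Real.toNNReal c ∧
      (Real.toNNReal c : ℝ≥0∞) < p x} = 0 := by
    intro c
    refine measure_null_of_locally_null _ fun x hx => ?_
    refine ⟨_, inter_mem_nhdsWithin _ (Metric.ball_mem_nhds x hr), ?_⟩
    have h1 : μ.restrict (Metric.ball x r) {y | (Real.toNNReal c : ℝ≥0∞) < p y} = 0 := by
      refine measure_mono_null (fun y hy => ?_) (ae_iff.1 (ENNReal.ae_le_essSup p))
      exact not_le.2 (hx.1.trans hy)
    refine measure_mono_null (fun y hy => ?_)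
      (le_antisymm ((Measure.le_restrict_apply _ _).trans h1.le) zero_le)
    exact ⟨hy.1.2, hy.2⟩
  rw [ae_iff]
  refine measure_mono_null (fun x hx => ?_) (measure_iUnion_null key)
  obtain ⟨c, -, h1, h2⟩ := ENNReal.lt_iff_exists_rat_btwn.1 (not_le.1 hx)
  exact mem_iUnion.2 ⟨c, h1, h2⟩

/-- Each `B(x, r)` contains one of finitely many balls of radius `r/2`. -/
lemma exists_ball_measure_lower_bound (hμ : BallsPosFinite μ)
    (hX : TotallyBounded (univ : Set X)) {r : ℝ} (hr : 0 < r) :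
    ∃ c : ℝ≥0∞, c ≠ 0 ∧ ∀ x, c ≤ μ (Metric.ball x r) := by
  obtain ⟨t, ht, hcov⟩ := Metric.totallyBounded_iff.1 hX (r / 2) (by positivity)
  refine ⟨ht.toFinset.inf fun y => μ (Metric.ball y (r / 2)), ?_, fun x => ?_⟩
  · refine ((Finset.lt_inf_iff (by simp)).2 fun y _ => (hμ y _ (by positivity)).1).ne'
  · obtain ⟨y, hy, hxy⟩ := mem_iUnion₂.1 (hcov (mem_univ x))
    refine (Finset.inf_le (ht.mem_toFinset.2 hy)).trans (measure_mono ?_)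
    refine Metric.ball_subset_ball' ?_
    rw [dist_comm]
    have := Metric.mem_ball.1 hxy
    linarith

lemma measure_univ_lt_top_of_totallyBounded (hμ : BallsPosFinite μ)
    (hX : TotallyBounded (univ : Set X)) : μ univ < ∞ := by
  obtain ⟨t, ht, hcov⟩ := Metric.totallyBounded_iff.1 hX 1 one_pos
  exact (measure_mono hcov).trans_lt
    (measure_biUnion_lt_top ht fun y _ => (hμ y 1 one_pos).2)

end Space

/-! ### Bounded exponents and the modular -/

section Modular

variable {X : Type*} [MeasurableSpace X] {μ : Measure X} {p q : X → ℝ≥0∞}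

lemma IsExponent.exists_lower_bound (hp : IsExponent p μ) :
    ∃ a : ℝ, 0 < a ∧ ∀ᵐ x ∂μ, ENNReal.ofReal a ≤ p x := by
  obtain ⟨a, ha0, ha⟩ := ENNReal.lt_iff_exists_nnreal_btwn.1 hp.essInf_pos
  refine ⟨a, by simpa using ha0, ?_⟩
  filter_upwards [ae_lt_of_lt_essInf ha] with x hx
  simpa using hx.le

lemma IsBoundedExponent.exists_bounds (hp : IsBoundedExponent p μ) :
    ∃ a b : ℝ, 0 < a ∧ 0 < b ∧
      ∀ᵐ x ∂μ, p x ≠ ∞ ∧ a ≤ (p x).toReal ∧ (p x).toReal ≤ b := by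
  obtain ⟨a, ha, hpa⟩ := hp.toIsExponent.exists_lower_bound
  refine ⟨a, (essSup p μ).toReal + 1, ha, by positivity, ?_⟩
  filter_upwards [hpa, ENNReal.ae_le_essSup p] with x h1 h2
  have h3 : p x ≠ ∞ := (h2.trans_lt hp.essSup_lt_top).ne
  refine ⟨h3, (ENNReal.ofReal_le_iff_le_toReal h3).1 h1, ?_⟩
  have := ENNReal.toReal_mono hp.essSup_lt_top.ne h2
  linarith

lemma modular_eq_lintegral (hp : ∀ᵐ x ∂μ, p x ≠ ∞) (f : X → ℝ≥0∞) :
    modular p μ f = ∫⁻ x, f x ^ (p x).toReal ∂μ := by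
  refine lintegral_congr_ae ?_
  filter_upwards [hp] with x hx
  simp [phi, hx]

lemma phi_mono (P : ℝ≥0∞) {s t : ℝ≥0∞} (h : s ≤ t) : phi P s ≤ phi P t := by
  unfold phi
  split_ifs with h1 h2 h3 h4
  · exact le_rfl
  · exact zero_le
  · exact absurd (h.trans h4) h2
  · exact le_rfl
  · exact ENNReal.rpow_le_rpow h ENNReal.toReal_nonneg

lemma modular_mono {f g : X → ℝ≥0∞} (h : ∀ᵐ x ∂μ, f x ≤ g x) :
    modular p μ f ≤ modular p μ g :=
  lintegral_mono_ae (h.mono fun x hx => phi_mono (p x) hx)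

lemma max_one_rpow_ne_top {c : ℝ≥0∞} (hc : c ≠ ∞) (b : ℝ) : max 1 c ^ b ≠ ∞ :=
  ENNReal.rpow_ne_top_of_ne_zero (zero_lt_one.trans_le (le_max_left 1 c)).ne'
    (max_lt ENNReal.one_lt_top hc.lt_top).ne

/-- The modular of `f` is controlled by the modular of `f / c`. -/
lemma lintegral_rpow_le_of_modular_div {b : ℝ} (hb : ∀ᵐ x ∂μ, p x ≠ ∞ ∧ (p x).toReal ≤ b)
    {f : X → ℝ≥0∞} {c : ℝ≥0∞} (hc0 : c ≠ 0) (hc : c ≠ ∞)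
    (h : modular p μ (fun x => f x / c) ≤ 1) :
    ∫⁻ x, f x ^ (p x).toReal ∂μ ≤ max 1 c ^ b := by
  rw [modular_eq_lintegral (hb.mono fun x hx => hx.1)] at h
  have hfin := max_one_rpow_ne_top hc b
  calc ∫⁻ x, f x ^ (p x).toReal ∂μ
      ≤ ∫⁻ x, max 1 c ^ b * (f x / c) ^ (p x).toReal ∂μ := by
        refine lintegral_mono_ae ?_
        filter_upwards [hb] with x hx
        calc f x ^ (p x).toReal = (c * (f x / c)) ^ (p x).toReal := by
              rw [ENNReal.mul_div_cancel hc0 hc]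
          _ = c ^ (p x).toReal * (f x / c) ^ (p x).toReal :=
              ENNReal.mul_rpow_of_nonneg _ _ ENNReal.toReal_nonneg
          _ ≤ _ := by
              gcongr
              exact rpow_le_max_one_rpow ENNReal.toReal_nonneg hx.2 c
    _ = max 1 c ^ b * ∫⁻ x, (f x / c) ^ (p x).toReal ∂μ := lintegral_const_mul' _ _ hfin
    _ ≤ max 1 c ^ b * 1 := by gcongr
    _ = _ := mul_one _

/-- Modular convergence implies norm convergence for bounded exponents. -/
lemma tendsto_lpNorm_zero {b : ℝ} (hb : ∀ᵐ x ∂μ, p x ≠ ∞ ∧ (p x).toReal ≤ b)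
    {f : ℕ → X → ℝ}
    (h : Tendsto (fun n => ∫⁻ x, ‖f n x‖ₑ ^ (p x).toReal ∂μ) atTop (𝓝 0)) :
    Tendsto (fun n => lpNorm p μ (f n)) atTop (𝓝 0) := by
  rw [ENNReal.tendsto_nhds_zero] at h ⊢
  intro ε hε
  -- With `c = min ε 1 ≤ 1`, dividing a function by `c` enlarges its modular by at most `c^(-b)`, so
  -- a modular below `c^b` forces norm at most `c`.
  have hc0 : min ε 1 ≠ 0 := (lt_min hε one_pos).ne'
  have hc1 : (min ε 1)⁻¹ ≠ ∞ := ENNReal.inv_ne_top.2 hc0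
  have hci : 1 ≤ (min ε 1)⁻¹ := ENNReal.one_le_inv.2 (min_le_right _ _)
  have hfin : (min ε 1)⁻¹ ^ b ≠ ∞ :=
    ENNReal.rpow_ne_top_of_ne_zero (zero_lt_one.trans_le hci).ne' hc1
  have hpos : 0 < ((min ε 1)⁻¹ ^ b)⁻¹ := ENNReal.inv_pos.2 hfin
  filter_upwards [h _ hpos] with n hn
  refine (sInf_le ?_).trans (min_le_left ε 1)
  refine ⟨pos_iff_ne_zero.2 hc0, (min_le_right _ _).trans_lt ENNReal.one_lt_top, ?_⟩
  rw [modular_eq_lintegral (hb.mono fun x hx => hx.1)]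
  calc ∫⁻ x, (‖f n x‖ₑ / min ε 1) ^ (p x).toReal ∂μ
      ≤ ∫⁻ x, (min ε 1)⁻¹ ^ b * ‖f n x‖ₑ ^ (p x).toReal ∂μ := by
        refine lintegral_mono_ae ?_
        filter_upwards [hb] with x hx
        rw [div_eq_mul_inv, mul_comm, ENNReal.mul_rpow_of_nonneg _ _ ENNReal.toReal_nonneg]
        gcongr
        exact hx.2
    _ = (min ε 1)⁻¹ ^ b * ∫⁻ x, ‖f n x‖ₑ ^ (p x).toReal ∂μ := lintegral_const_mul' _ _ hfin
    _ ≤ (min ε 1)⁻¹ ^ b * ((min ε 1)⁻¹ ^ b)⁻¹ := by gcongr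
    _ ≤ 1 := ENNReal.mul_inv_le_one _

lemma exists_modular_div_le_one {f : X → ℝ≥0∞} {C : ℝ≥0∞} (h : lpNormE p μ f < C) :
    modular p μ (fun x => f x / C) ≤ 1 := by
  obtain ⟨c, ⟨-, -, hc⟩, hcC⟩ := sInf_lt_iff.1 h
  refine (modular_mono (Eventually.of_forall fun x => ?_)).trans hc
  exact ENNReal.div_le_div_left hcC.le _

lemma exists_lintegral_bound_of_lpNorm_le (hp : IsBoundedExponent p μ) {u : ℕ → X → ℝ} {C : ℝ≥0}
    (h : ∀ n, lpNorm p μ (u n) ≤ C) :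
    ∃ K : ℝ≥0∞, K ≠ ∞ ∧ ∀ n, ∫⁻ x, ‖u n x‖ₑ ^ (p x).toReal ∂μ ≤ K := by
  obtain ⟨a, b, -, -, hab⟩ := hp.exists_bounds
  have hC : (C : ℝ≥0∞) < C + 1 := ENNReal.lt_add_right ENNReal.coe_ne_top one_ne_zero
  refine ⟨_, max_one_rpow_ne_top (c := (C : ℝ≥0∞) + 1) (by simp) b, fun n => ?_⟩
  exact lintegral_rpow_le_of_modular_div (hab.mono fun x hx => ⟨hx.1, hx.2.2⟩) (by simp) (by simp)
    (exists_modular_div_le_one ((h n).trans_lt hC))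

end Modular

/-! ### Uniform bounds for gradients -/

section Gradients

variable {X : Type*} [MetricSpace X] [MeasurableSpace X] {μ : Measure X} {s p q : X → ℝ≥0∞}

lemma le_ellNorm {Q : ℝ≥0∞} (hQ : Q ≠ 0) (g : ℤ → ℝ≥0∞) (k : ℤ) : g k ≤ ellNorm Q g := by
  unfold ellNorm
  split_ifs with h
  · exact le_iSup g k
  · have h0 : 0 < Q.toReal := ENNReal.toReal_pos hQ h
    rw [← ENNReal.rpow_le_rpow_iff h0, ← ENNReal.rpow_mul, one_div_mul_cancel h0.ne',
      ENNReal.rpow_one]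
    exact ENNReal.le_tsum k

/-- The family `u` has vector gradients all of whose entries have modular at most `K`. -/
def GradientBound (s p : X → ℝ≥0∞) (μ : Measure X) (u : ℕ → X → ℝ) (K : ℝ≥0∞) : Prop :=
  ∀ n, ∃ g ∈ vectorGradients s μ (u n), ∀ k, ∫⁻ x, g k x ^ (p x).toReal ∂μ ≤ K

lemma exists_gradientBound_of_tlSeminorm_le (hp : IsBoundedExponent p μ) (hq : IsExponent q μ)
    {u : ℕ → X → ℝ} {C : ℝ≥0} (h : ∀ n, tlSeminorm s p q μ (u n) ≤ C) :
    ∃ K : ℝ≥0∞, K ≠ ∞ ∧ GradientBound s p μ u K := by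
  obtain ⟨a, b, -, -, hab⟩ := hp.exists_bounds
  have hC : (C : ℝ≥0∞) < C + 1 := ENNReal.lt_add_right ENNReal.coe_ne_top one_ne_zero
  refine ⟨_, max_one_rpow_ne_top (c := (C : ℝ≥0∞) + 1) (by simp) b, fun n => ?_⟩
  obtain ⟨g, hg⟩ := iInf_lt_iff.1 ((h n).trans_lt hC)
  obtain ⟨hgu, hg⟩ := iInf_lt_iff.1 hg
  refine ⟨g, hgu, fun k => ?_⟩
  refine lintegral_rpow_le_of_modular_div (hab.mono fun x hx => ⟨hx.1, hx.2.2⟩) (by simp) (by simp)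
    ((modular_mono (Eventually.of_forall fun x => ?_)).trans (exists_modular_div_le_one hg))
  exact ENNReal.div_le_div_right (le_ellNorm (hq.pos x).ne' (fun k => g k x) k) _

lemma exists_gradientBound_of_besovSeminorm_le (hp : IsBoundedExponent p μ) (hq : IsExponent q μ)
    {u : ℕ → X → ℝ} {C : ℝ≥0} (h : ∀ n, besovSeminorm s p q μ (u n) ≤ C) :
    ∃ K : ℝ≥0∞, K ≠ ∞ ∧ GradientBound s p μ u K := by
  obtain ⟨a, b, -, -, hab⟩ := hp.exists_bounds
  obtain ⟨d, hd, hdq⟩ := hq.exists_lower_bound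
  have hC : (C : ℝ≥0∞) < C + 1 := ENNReal.lt_add_right ENNReal.coe_ne_top one_ne_zero
  have hD : ((2 : ℝ≥0∞) ^ d⁻¹) ≠ ∞ := ENNReal.rpow_ne_top_of_nonneg (by positivity) (by simp)
  have hD0 : ((2 : ℝ≥0∞) ^ d⁻¹) ≠ 0 := (ENNReal.rpow_pos (by simp) (by simp)).ne'
  have hc : (2 : ℝ≥0∞) ^ d⁻¹ * ((C : ℝ≥0∞) + 1) ≠ ∞ := ENNReal.mul_ne_top hD (by simp)
  refine ⟨_, max_one_rpow_ne_top hc b, fun n => ?_⟩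
  obtain ⟨g, hg⟩ := iInf_lt_iff.1 ((h n).trans_lt hC)
  obtain ⟨hgu, hg⟩ := iInf_lt_iff.1 hg
  obtain ⟨c, ⟨hc0, hct, hc1⟩, hcC⟩ := sInf_lt_iff.1 hg
  refine ⟨g, hgu, fun k => ?_⟩
  -- The infimum is at most 1 but need not be attained; the slack up to 2 provides an admissible `l
  -- < 2`, and then `l^(1/q) ≤ 2^(1/d)` because `q ≥ d` almost everywhere.
  have h2 := ((ENNReal.le_tsum k).trans hc1).trans_lt (show (1 : ℝ≥0∞) < 2 by norm_num)
  obtain ⟨l, ⟨hl0, hlt, hl⟩, hl2⟩ := sInf_lt_iff.1 h2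
  refine lintegral_rpow_le_of_modular_div (hab.mono fun x hx => ⟨hx.1, hx.2.2⟩)
    (mul_ne_zero hD0 (by simp)) hc ((modular_mono ?_).trans hl)
  filter_upwards [hdq] with x hx
  have h3 : l ^ ((q x)⁻¹).toReal ≤ 2 ^ d⁻¹ := by
    refine (ENNReal.rpow_le_rpow hl2.le ENNReal.toReal_nonneg).trans
      (ENNReal.rpow_le_rpow_of_exponent_le (by norm_num) ?_)
    have := ENNReal.toReal_mono (by simp [hd]) (ENNReal.inv_le_inv.2 hx)
    rwa [ENNReal.toReal_inv (ENNReal.ofReal d), ENNReal.toReal_ofReal hd.le] at this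
  calc g k x / (2 ^ d⁻¹ * ((C : ℝ≥0∞) + 1))
      = g k x / ((C : ℝ≥0∞) + 1) / 2 ^ d⁻¹ := by
        rw [div_eq_mul_inv, div_eq_mul_inv, div_eq_mul_inv, mul_assoc,
          ENNReal.mul_inv (Or.inl hD0) (Or.inl hD), mul_comm (2 ^ d⁻¹)⁻¹]
    _ ≤ g k x / c / l ^ ((q x)⁻¹).toReal := by gcongr

/-- Increments over small distances are controlled by functions of small modular. -/
def SmallIncrements (p : X → ℝ≥0∞) (μ : Measure X) (u : ℕ → X → ℝ) : Prop :=
  ∀ ε : ℝ≥0∞, ε ≠ 0 → ∃ r : ℝ, 0 < r ∧ ∀ n, ∃ G : X → ℝ≥0∞, AEMeasurable G μ ∧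
    ∫⁻ x, G x ^ (p x).toReal ∂μ ≤ ε ∧ ∃ N : Set X, μ N = 0 ∧
      ∀ x y, x ∉ N → y ∉ N → dist x y < r → ‖u n x - u n y‖ₑ ≤ G x + G y

lemma GradientBound.smallIncrements (hp : IsBoundedExponent p μ) (hs : IsBoundedExponent s μ)
    {u : ℕ → X → ℝ} {K : ℝ≥0∞} (hK : K ≠ ∞) (h : GradientBound s p μ u K) :
    SmallIncrements p μ u := by
  obtain ⟨a, b, ha, -, hab⟩ := hp.exists_bounds
  obtain ⟨a', b', ha', -, hab'⟩ := hs.exists_bounds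
  intro ε hε
  -- Since `s ≥ a'` and `p ≥ a`, the weight `2^(-j s(x))` raised to the power `p(x)` is at most
  -- `θ^j`.
  set θ : ℝ≥0∞ := (2⁻¹ : ℝ≥0∞) ^ (a' * a) with hθ
  have hθ1 : θ < 1 := ENNReal.rpow_lt_one (by norm_num) (by positivity)
  have htend : Tendsto (fun m : ℕ => θ ^ m * (K * (1 - θ)⁻¹)) atTop (𝓝 0) := by
    have := ENNReal.Tendsto.mul_const (b := K * (1 - θ)⁻¹)
      (ENNReal.tendsto_pow_atTop_nhds_zero_of_lt_one hθ1)
      (Or.inr (ENNReal.mul_ne_top hK (ENNReal.inv_ne_top.2 (tsub_pos_of_lt hθ1).ne')))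
    simpa using this
  obtain ⟨m, hm⟩ := ((ENNReal.tendsto_nhds_zero.1 htend) ε (pos_iff_ne_zero.2 hε)).exists
  refine ⟨2 ^ (-(m : ℤ)), by positivity, fun n => ?_⟩
  obtain ⟨g, ⟨hgm, N, hN, hg⟩, hgK⟩ := h n
  set w : ℕ → X → ℝ≥0∞ := fun i x =>
    ENNReal.ofReal ((2 : ℝ) ^ (-((m + i : ℕ) : ℝ) * (s x).toReal)) * g ((m + i : ℕ) : ℤ) x with hw
  have hpm : Measurable fun x => (p x).toReal := hp.measurable.ennreal_toReal
  have hsm : Measurable fun x => (s x).toReal := hs.measurable.ennreal_toReal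
  have hwm : ∀ i, AEMeasurable (w i) μ := fun i => by
    refine AEMeasurable.mul ?_ (hgm _)
    exact (ENNReal.measurable_ofReal.comp
      (measurable_const.pow (measurable_const.mul hsm))).aemeasurable
  have hwp : ∀ i, AEMeasurable (fun x => w i x ^ (p x).toReal) μ := fun i =>
    (hwm i).pow hpm.aemeasurable
  have hwK : ∀ i, ∫⁻ x, w i x ^ (p x).toReal ∂μ ≤ θ ^ m * (θ ^ i * K) := by
    intro i
    calc ∫⁻ x, w i x ^ (p x).toReal ∂μ
        ≤ ∫⁻ x, θ ^ (m + i) * g ((m + i : ℕ) : ℤ) x ^ (p x).toReal ∂μ := by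
          refine lintegral_mono_ae ?_
          filter_upwards [hab, hab'] with x hx hx'
          rw [hw]
          simp only
          rw [ENNReal.mul_rpow_of_nonneg _ _ ENNReal.toReal_nonneg]
          gcongr
          rw [hθ, ← ENNReal.rpow_mul_natCast, ← ENNReal.ofReal_rpow_of_pos two_pos,
            ← ENNReal.rpow_mul, ENNReal.inv_rpow, ← ENNReal.rpow_neg, ENNReal.ofReal_ofNat]
          refine ENNReal.rpow_le_rpow_of_exponent_le (by norm_num) ?_
          have h1 : a' * a ≤ (s x).toReal * (p x).toReal :=
            mul_le_mul hx'.2.1 hx.2.1 ha.le ENNReal.toReal_nonneg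
          have h2 : (0 : ℝ) ≤ ((m + i : ℕ) : ℝ) := Nat.cast_nonneg _
          nlinarith
      _ = θ ^ (m + i) * ∫⁻ x, g ((m + i : ℕ) : ℤ) x ^ (p x).toReal ∂μ :=
          lintegral_const_mul' _ _ (ENNReal.pow_ne_top hθ1.ne_top)
      _ ≤ θ ^ (m + i) * K := by gcongr; exact hgK _
      _ = _ := by rw [pow_add, mul_assoc]
  -- The pointwise `ℓ^{p(x)}` norm dominates every `w i`, and its modular is exactly the sum of the
  -- modulars, also where `p < 1`.
  refine ⟨fun x => (∑' i, w i x ^ (p x).toReal) ^ ((p x).toReal)⁻¹, ?_, ?_,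
    N ∪ {x | ¬ (a ≤ (p x).toReal)}, ?_, ?_⟩
  · exact (AEMeasurable.tsum hwp).pow hpm.inv.aemeasurable
  · calc ∫⁻ x, ((∑' i, w i x ^ (p x).toReal) ^ ((p x).toReal)⁻¹) ^ (p x).toReal ∂μ
        = ∫⁻ x, ∑' i, w i x ^ (p x).toReal ∂μ := by
          refine lintegral_congr_ae ?_
          filter_upwards [hab] with x hx
          rw [← ENNReal.rpow_mul, inv_mul_cancel₀ (ha.trans_le hx.2.1).ne', ENNReal.rpow_one]
      _ = ∑' i, ∫⁻ x, w i x ^ (p x).toReal ∂μ := lintegral_tsum hwp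
      _ ≤ ∑' i, θ ^ m * (θ ^ i * K) := ENNReal.tsum_le_tsum hwK
      _ = θ ^ m * (K * (1 - θ)⁻¹) := by
          rw [ENNReal.tsum_mul_left, ENNReal.tsum_mul_right, ENNReal.tsum_geometric, mul_comm K]
      _ ≤ ε := hm
  · refine measure_union_null hN ?_
    exact ae_iff.1 (hab.mono fun x hx => hx.2.1)
  · intro x y hx hy hxy
    rcases eq_or_ne x y with rfl | hne
    · simp
    have hd0 : 0 < dist x y := dist_pos.2 hne
    -- Here `2^k ≤ d(x, y) < 2^(k+1)`, which is level `-(k+1)` in the convention of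
    -- `vectorGradients`; `d(x, y) < 2^(-m)` forces this level to be at least `m`.
    obtain ⟨k, hk1, hk2⟩ := exists_mem_Ico_zpow hd0 (one_lt_two (α := ℝ))
    obtain ⟨i, hi⟩ : ∃ i : ℕ, -(k + 1) = ((m + i : ℕ) : ℤ) := by
      have : k < -(m : ℤ) := (zpow_lt_zpow_iff_right₀ (one_lt_two (α := ℝ))).1 (hk1.trans_lt hxy)
      exact ⟨(-(k + 1) - m).toNat, by push_cast; omega⟩
    have hle : ∀ z, z ∉ N ∪ {x | ¬ (a ≤ (p x).toReal)} →
        ENNReal.ofReal (dist x y ^ (s z).toReal) * g (-(k + 1)) z ≤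
          (∑' i, w i z ^ (p z).toReal) ^ ((p z).toReal)⁻¹ := by
      intro z hz
      have hz' : a ≤ (p z).toReal := by
        by_contra hcon; exact hz (Or.inr hcon)
      have h0 : 0 < (p z).toReal := ha.trans_le hz'
      refine le_trans ?_ ((ENNReal.le_rpow_inv_iff h0).2
        (ENNReal.le_tsum (f := fun i => w i z ^ (p z).toReal) i))
      rw [hw, hi]
      simp only
      gcongr
      rw [Real.rpow_mul two_pos.le]
      refine Real.rpow_le_rpow hd0.le ?_ ENNReal.toReal_nonneg
      have : (-((m + i : ℕ) : ℝ)) = ((k + 1 : ℤ) : ℝ) := by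
        rw [eq_comm, ← neg_inj, neg_neg, ← Int.cast_neg, hi]; simp
      rw [this, Real.rpow_intCast]
      exact hk2.le
    have := hg (-(k + 1)) x y (fun h => hx (Or.inl h)) (fun h => hy (Or.inl h))
      (by simpa using hk1) (by simpa using hk2)
    rw [Real.enorm_eq_ofReal_abs]
    exact this.trans (add_le_add (hle x hx) (hle y hy))

end Gradients

/-! ### Local domination -/

section Domination

lemma measure_pos_of_ae_imp {X : Type*} [MeasurableSpace X] {μ : Measure X} {S T : Set X}
    (hS : 0 < μ S) (h : ∀ᵐ y ∂μ, y ∈ S → y ∈ T) :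
    0 < μ T :=
  hS.trans_le (measure_mono_ae h)

variable {X : Type*} [MetricSpace X] [MeasurableSpace X] {μ : Measure X} {p : X → ℝ≥0∞}

/-- For functions `h` of bounded modular, `h(y) ^ p(x) ≤ Φ(x)` for many `y` in the ball
`B(x, r)`, with an integrable function `Φ` which does not depend on `h`. -/
def LocallyDominated (p : X → ℝ≥0∞) (μ : Measure X) : Prop :=
  ∀ r : ℝ, 0 < r → ∀ K : ℝ≥0∞, K ≠ ∞ → ∃ Φ : X → ℝ≥0∞, Measurable Φ ∧ ∫⁻ x, Φ x ∂μ ≠ ∞ ∧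
    ∀ h : X → ℝ≥0∞, AEMeasurable h μ → ∫⁻ x, h x ^ (p x).toReal ∂μ ≤ K →
      ∀ᵐ x ∂μ, 0 < μ {y | y ∈ Metric.ball x r ∧ h y ^ (p x).toReal ≤ Φ x}

/-- Chebyshev's inequality on balls. -/
lemma measure_ball_le_div_pos (hμ : BallsPosFinite μ) {f : X → ℝ≥0∞} (hf : AEMeasurable f μ)
    {K : ℝ≥0∞} (hK : ∫⁻ x, f x ∂μ ≤ K) (x : X) {r : ℝ} (hr : 0 < r) :
    0 < μ {y | y ∈ Metric.ball x r ∧ f y ≤ K / μ (Metric.ball x r)} := by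
  refine (measure_le_setLAverage_pos (hμ x r hr).1.ne' (hμ x r hr).2.ne hf.restrict).trans_le
    (measure_mono fun y hy => ⟨hy.1, hy.2.trans ?_⟩)
  rw [setLAverage_eq]
  gcongr
  exact (setLIntegral_le_lintegral _ _).trans hK

/-- Balls of radius `r` have measure at least `c`, so Chebyshev gives `h(y)^p(y) ≤ K/c`. Passing to
the exponent `p(x)` costs a power at most `b/a`, and the resulting constant is integrable because
`μ` is finite. -/
lemma locallyDominated_of_totallyBounded (hμ : BallsPosFinite μ) (hp : IsBoundedExponent p μ)
    (hX : TotallyBounded (univ : Set X)) : LocallyDominated p μ := by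
  obtain ⟨a, b, ha, hb, hab⟩ := hp.exists_bounds
  intro r hr K hK
  obtain ⟨c, hc0, hc⟩ := exists_ball_measure_lower_bound hμ hX hr
  set L : ℝ≥0∞ := max 1 (K / c) ^ (b / a) with hL
  refine ⟨fun _ => L, measurable_const, ?_, fun h hh hhK => ?_⟩
  · rw [lintegral_const]
    exact ENNReal.mul_ne_top (max_one_rpow_ne_top (ENNReal.div_ne_top hK hc0) _)
      (measure_univ_lt_top_of_totallyBounded hμ hX).ne
  filter_upwards [hab] with x hx
  refine measure_pos_of_ae_imp (measure_ball_le_div_pos hμ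
    (hh.pow hp.measurable.ennreal_toReal.aemeasurable) hhK x hr) ?_
  filter_upwards [hab] with y hy hyS
  refine ⟨hyS.1, ?_⟩
  have hQ : 0 < (p y).toReal := ha.trans_le hy.2.1
  have h1 : h y ≤ max 1 (K / c) ^ (1 / a) := by
    have h2 : h y ≤ (max 1 (K / c)) ^ ((p y).toReal)⁻¹ := by
      rw [ENNReal.le_rpow_inv_iff hQ]
      exact hyS.2.trans ((ENNReal.div_le_div_left (hc x) _).trans (le_max_right _ _))
    refine h2.trans (ENNReal.rpow_le_rpow_of_exponent_le (le_max_left _ _) ?_)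
    rw [one_div]
    exact inv_anti₀ ha hy.2.1
  calc h y ^ (p x).toReal ≤ (max 1 (K / c) ^ (1 / a)) ^ (p x).toReal :=
        ENNReal.rpow_le_rpow h1 ENNReal.toReal_nonneg
    _ = max 1 (K / c) ^ (1 / a * (p x).toReal) := (ENNReal.rpow_mul _ _ _).symm
    _ ≤ L := by
        refine ENNReal.rpow_le_rpow_of_exponent_le (le_max_left _ _) ?_
        rw [one_div, inv_mul_eq_div]
        exact div_le_div_of_nonneg_right hx.2.2 ha.le

/-- Change of exponent on a small ball of measure `m`. -/
lemma rpow_le_of_ball_small {a b C K m h P Q : ℝ} (ha : 0 < a) (hP : 0 < P) (hPb : P ≤ b)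
    (haQ : a ≤ Q) (hC : 1 ≤ C) (hK : 1 ≤ K) (hm : 0 < m) (hh : 0 ≤ h)
    (hhK : h ^ Q ≤ K / m) (hlog : m ^ (1 / P - 1 / Q) ≤ C) :
    h ^ P ≤ K ^ (b / a) * C ^ b * (1 / m) := by
  have hQ : 0 < Q := ha.trans_le haQ
  have h1 : h ^ P ≤ (K / m) ^ (P / Q) := by
    have := Real.rpow_le_rpow (by positivity) hhK (div_nonneg hP.le hQ.le)
    rwa [← Real.rpow_mul hh, mul_div_cancel₀ _ hQ.ne'] at this
  refine h1.trans ?_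
  rw [div_eq_mul_one_div K m, Real.mul_rpow (by positivity) (by positivity), mul_assoc]
  have hPQ : P / Q ≤ b / a := div_le_div₀ (hP.le.trans hPb) hPb ha haQ
  refine mul_le_mul (Real.rpow_le_rpow_of_exponent_le hK hPQ) ?_ (by positivity) (by positivity)
  -- One factor `1/m` is split off; the remainder is a power of the quantity bounded by `C`.
  have h2 : (1 / m) ^ (P / Q) = (m ^ (1 / P - 1 / Q)) ^ P * (1 / m) := by
    rw [← Real.rpow_mul hm.le, one_div, Real.inv_rpow hm.le, ← Real.rpow_neg hm.le,
      ← Real.rpow_neg_one m, ← Real.rpow_add hm]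
    congr 1
    field_simp
    ring
  rw [h2]
  gcongr
  exact (Real.rpow_le_rpow (by positivity) hlog hP.le).trans
    (Real.rpow_le_rpow_of_exponent_le hC hPb)

/-- Change of exponent on a ball of measure `m ≥ 1`. -/
lemma rpow_le_of_ball_large {a b c K m h P Q w : ℝ} (ha : 0 < a) (hP : 0 < P)
    (hPb : P ≤ b) (haQ : a ≤ Q) (hc : 0 < c) (hc1 : c ≤ 1) (hK : 1 ≤ K) (hm1 : 1 ≤ m)
    (hh : 0 ≤ h) (hhK : h ^ Q ≤ K / m) (hw : 0 ≤ w)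
    (hdec : P < Q → c ^ (2 * (1 / P - 1 / Q)⁻¹) ≤ w + K / m) :
    h ^ P ≤ K ^ (b / a) * (c ^ (-(2 * b))) * (w + 2 * (K / m)) := by
  have hQ : 0 < Q := ha.trans_le haQ
  have hm : 0 < m := one_pos.trans_le hm1
  have hK0 : 0 < K := one_pos.trans_le hK
  -- Normalisation: `m ≥ 1` gives `h^Q ≤ K`, so `h / L ≤ 1`.
  set L : ℝ := K ^ (1 / Q) with hL
  have hL0 : 0 < L := by positivity
  have hLQ : L ^ Q = K := by
    rw [hL, ← Real.rpow_mul hK0.le, one_div_mul_cancel hQ.ne', Real.rpow_one]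
  have hh1 : (h / L) ^ Q ≤ K / m := by
    rw [Real.div_rpow hh hL0.le, hLQ]
    exact (div_le_self (by positivity) hK).trans hhK
  have hhL : h / L ≤ 1 := by
    have h1 : h ^ Q ≤ K := hhK.trans (div_le_self hK0.le hm1)
    rw [div_le_one hL0, ← Real.rpow_le_rpow_iff hh hL0.le hQ, hLQ]
    exact h1
  have hhL0 : 0 ≤ h / L := by positivity
  have hcb : 1 ≤ c ^ (-(2 * b)) :=
    Real.one_le_rpow_of_pos_of_le_one_of_nonpos hc hc1 (by linarith)
  have hLP : L ^ P ≤ K ^ (b / a) := by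
    rw [hL, ← Real.rpow_mul hK0.le]
    refine Real.rpow_le_rpow_of_exponent_le hK ?_
    rw [one_div, inv_mul_eq_div]
    exact div_le_div₀ (hP.le.trans hPb) hPb ha haQ
  have hKm : 0 ≤ K / m := by positivity
  have key : (h / L) ^ P ≤ c ^ (-(2 * b)) * (w + 2 * (K / m)) := by
    -- For `Q ≤ P`, raising the exponent only decreases a number in `[0, 1]`. For `P < Q`, Young's
    -- inequality with `γ = c^2` leaves the error `c^(2τ)`, which `hdec` controls.
    rcases le_or_gt Q P with hQP | hPQ
    · calc (h / L) ^ P ≤ (h / L) ^ Q := Real.rpow_le_rpow_of_exponent_ge_of_imp hhL0 hhL hQP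
            (fun _ h0 => absurd h0 hP.ne')
        _ ≤ 1 * (w + 2 * (K / m)) := by linarith
        _ ≤ _ := by gcongr
    · have hτ : 0 < 1 / P - 1 / Q := sub_pos.2 (one_div_lt_one_div_of_lt hP hPQ)
      have h1 := mul_rpow_le_rpow_add (γ := c ^ (2 : ℝ)) (τ := (1 / P - 1 / Q)⁻¹) hhL0
        (by positivity) hP hQ (by positivity) (by rw [one_div (_⁻¹), inv_inv]; ring)
      rw [← Real.rpow_mul hc.le, Real.mul_rpow (by positivity) hhL0, ← Real.rpow_mul hc.le] at h1
      have h2 : c ^ (2 * b) * (h / L) ^ P ≤ w + 2 * (K / m) := by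
        refine le_trans ?_ (h1.trans (by linarith [hdec hPQ]))
        gcongr ?_ * _
        exact Real.rpow_le_rpow_of_exponent_ge hc hc1 (by linarith)
      rw [Real.rpow_neg hc.le, inv_mul_eq_div, le_div_iff₀ (by positivity), mul_comm]
      exact h2
  calc h ^ P = L ^ P * (h / L) ^ P := by
        rw [← Real.mul_rpow hL0.le hhL0, mul_div_cancel₀ _ hL0.ne']
    _ ≤ K ^ (b / a) * (c ^ (-(2 * b)) * (w + 2 * (K / m))) := by gcongr
    _ = _ := by ring

/-- Powers of `c ≤ 1` decrease in the exponent and `1/e ≤ 2/d`. The factor 2 is what remains when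
`d` is a gap `1/p(x) - 1/p(y)` split at `1/p_∞`: it is at most twice the larger of the two
deviations `e`. -/
lemma phi_inv_ofReal_one_le {c d e : ℝ} (hc : 0 < c) (hc1 : c ≤ 1) (hd : 0 < d)
    (hde : d ≤ 2 * e) :
    ENNReal.ofReal (c ^ (2 * d⁻¹)) ≤ phi (ENNReal.ofReal e)⁻¹ (ENNReal.ofReal c) := by
  have he : 0 < e := by linarith
  have h1 : (ENNReal.ofReal e)⁻¹ ≠ ∞ := by simpa using he
  rw [phi, if_neg h1, ENNReal.toReal_inv, ENNReal.toReal_ofReal he.le,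
    ENNReal.ofReal_rpow_of_pos hc]
  refine ENNReal.ofReal_le_ofReal (Real.rpow_le_rpow_of_exponent_ge hc hc1 ?_)
  rw [← one_div, ← one_div, mul_one_div, div_le_div_iff₀ he hd]
  linarith

/-- The majorant is a multiple of `1/μ(B(x, r)) + w(x)`, where `w = φ_t(c)` is integrable by the
decay condition. On balls of measure at most 1 the change of exponent is paid for by the log
condition, on larger balls by `w`. -/
lemma locallyDominated_of_integrable [BorelSpace X] [SecondCountableTopology X]
    (hμ : BallsPosFinite μ) (hi : IsIntegrableMeasure μ) (hp : IsLogExponent p μ) :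
    LocallyDominated p μ := by
  have := hμ.sigmaFinite
  obtain ⟨a, b, ha, hb, hab⟩ := hp.toIsBoundedExponent.exists_bounds
  obtain ⟨C₀, hC₀, hC⟩ := hp.ball_bound
  obtain ⟨pinf, -, -, c₀, hc₀, hc₀t, hdecay⟩ := hp.decay
  set e : X → ℝ := fun x => |((p x)⁻¹).toReal - (pinf⁻¹).toReal| with he
  -- The cap at 1 makes `φ_∞(c) = 0` at points where `t = ∞`, and makes powers of `c` decreasing in
  -- the exponent.
  set c : ℝ := min c₀.toReal 1 with hcdef
  have hc : 0 < c := lt_min (ENNReal.toReal_pos hc₀.ne' hc₀t.ne) one_pos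
  have hc1 : c ≤ 1 := min_le_right _ _
  set w : X → ℝ≥0∞ := fun x => phi (ENNReal.ofReal (e x))⁻¹ (ENNReal.ofReal c) with hw
  have hem : Measurable e :=
    (continuous_abs.measurable.comp (hp.measurable.inv.ennreal_toReal.sub_const _))
  have hwm : Measurable w := by
    have ht : Measurable fun x => (ENNReal.ofReal (e x))⁻¹ := hem.ennreal_ofReal.inv
    refine Measurable.ite (ht (measurableSet_singleton ∞)) measurable_const ?_
    exact measurable_const.pow ht.ennreal_toReal
  have hwi : ∫⁻ x, w x ∂μ ≠ ∞ := by
    refine ((modular_mono (Eventually.of_forall fun x => ?_)).trans_lt hdecay).ne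
    rw [enorm_one, mul_one]
    exact (ENNReal.ofReal_le_ofReal (min_le_left _ _)).trans_eq (ENNReal.ofReal_toReal hc₀t.ne)
  have hwfin : ∀ x, w x ≠ ∞ := fun x => by
    rw [hw]
    simp only [phi]
    split_ifs with h1 h2
    · simp
    · exact absurd (ENNReal.ofReal_le_one.2 hc1) h2
    · exact ENNReal.rpow_ne_top_of_ne_zero (by simpa using hc) ENNReal.ofReal_ne_top
  intro r hr K hK
  set K' : ℝ := max 1 (K + ∫⁻ x, w x ∂μ).toReal with hK'
  have hKK' : K + ∫⁻ x, w x ∂μ ≤ ENNReal.ofReal K' := by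
    rw [ENNReal.le_ofReal_iff_toReal_le (ENNReal.add_ne_top.2 ⟨hK, hwi⟩) (by positivity)]
    exact le_max_right _ _
  set C : ℝ := max 1 C₀.toReal with hCdef
  -- The sum of the constants for balls of measure at most 1 and greater than 1.
  set A : ℝ := K' ^ (b / a) * C ^ b + K' ^ (b / a) * c ^ (-(2 * b)) * (2 * K') with hA
  have hK'1 : 1 ≤ K' := le_max_left _ _
  have hK'0 : 0 < K' := one_pos.trans_le hK'1
  have hC1 : 1 ≤ C := le_max_left _ _
  have hC0 : 0 < C := one_pos.trans_le hC1
  refine ⟨fun x => ENNReal.ofReal A * ((μ (Metric.ball x r))⁻¹ + w x), ?_, ?_,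
    fun h hh hhK => ?_⟩
  · exact ((measurable_measure_ball r).inv.add hwm).const_mul _
  · rw [lintegral_const_mul' _ _ ENNReal.ofReal_ne_top, lintegral_add_right _ hwm]
    exact ENNReal.mul_ne_top ENNReal.ofReal_ne_top (ENNReal.add_ne_top.2 ⟨(hi r hr).ne, hwi⟩)
  have hhp : AEMeasurable (fun x => h x ^ (p x).toReal) μ :=
    hh.pow hp.measurable.ennreal_toReal.aemeasurable
  -- Chebyshev is applied to the sum, so that the same `y` satisfies the bounds on `h(y)^p(y)` and
  -- on `w(y)`.
  have hint : ∫⁻ x, (h x ^ (p x).toReal + w x) ∂μ ≤ ENNReal.ofReal K' := by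
    rw [lintegral_add_right _ hwm]
    exact (add_le_add hhK le_rfl).trans hKK'
  filter_upwards [hab, ae_le_essSup_ball (μ := μ) p hr] with x hx hxB
  have hB0 := (hμ x r hr).1
  have hBt := (hμ x r hr).2
  refine measure_pos_of_ae_imp (measure_ball_le_div_pos hμ (hhp.add hwm.aemeasurable)
    hint x hr) ?_
  have hinf := (ae_restrict_iff' Metric.isOpen_ball.measurableSet).1
    (ae_essInf_le (μ := μ.restrict (Metric.ball x r)) (f := p))
  filter_upwards [hab, hinf] with y hy hyinf hyS
  refine ⟨hyS.1, ?_⟩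
  obtain ⟨hyB, hyS⟩ := hyS
  have hP := ha.trans_le hx.2.1
  have hQ := ha.trans_le hy.2.1
  set m : ℝ := (μ (Metric.ball x r)).toReal with hm
  have hm0 : 0 < m := ENNReal.toReal_pos hB0.ne' hBt.ne
  have hBm : μ (Metric.ball x r) = ENNReal.ofReal m := (ENNReal.ofReal_toReal hBt.ne).symm
  rw [hBm, ← ENNReal.ofReal_div_of_pos hm0, Pi.add_apply] at hyS
  have hhy : h y ≠ ∞ := fun h0 => by
    rw [h0, ENNReal.top_rpow_of_pos hQ, top_add, top_le_iff] at hyS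
    exact ENNReal.ofReal_ne_top hyS
  set H : ℝ := (h y).toReal with hH
  have hH0 : 0 ≤ H := ENNReal.toReal_nonneg
  have hyH : h y = ENNReal.ofReal H := (ENNReal.ofReal_toReal hhy).symm
  have hxw : w x = ENNReal.ofReal (w x).toReal := (ENNReal.ofReal_toReal (hwfin x)).symm
  have hKm : 0 ≤ K' / m := by positivity
  have hHK : H ^ (p y).toReal ≤ K' / m := by
    rw [← ENNReal.ofReal_le_ofReal_iff hKm, ← ENNReal.ofReal_rpow_of_nonneg hH0 hQ.le, ← hyH]
    exact le_self_add.trans hyS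
  have hwy : w y ≤ ENNReal.ofReal (K' / m) := le_add_self.trans hyS
  rw [hyH, hBm, hxw, ENNReal.ofReal_rpow_of_nonneg hH0 hP.le, ← ENNReal.ofReal_inv_of_pos hm0,
    ← ENNReal.ofReal_add (by positivity) ENNReal.toReal_nonneg,
    ← ENNReal.ofReal_mul (by positivity)]
  refine ENNReal.ofReal_le_ofReal ?_
  set W : ℝ := (w x).toReal with hW
  have hW0 : 0 ≤ W := ENNReal.toReal_nonneg
  have hinv : ∀ z, ((p z)⁻¹).toReal = 1 / (p z).toReal := fun z => by
    rw [ENNReal.toReal_inv, one_div]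
  have hA1 : 0 ≤ K' ^ (b / a) * C ^ b := by positivity
  have hA2 : 0 ≤ K' ^ (b / a) * c ^ (-(2 * b)) := by positivity
  have hm' : 0 ≤ m⁻¹ := by positivity
  rcases le_or_gt m 1 with hm1 | hm1
  · refine (rpow_le_of_ball_small ha hP hx.2.2 hy.2.1 hC1 hK'1 hm0 hH0 hHK ?_).trans ?_
    · set B₂ := essSup p (μ.restrict (Metric.ball x r))
      set B₁ := essInf p (μ.restrict (Metric.ball x r))
      have h1 : (B₂⁻¹).toReal ≤ 1 / (p x).toReal := by
        rw [← hinv]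
        refine ENNReal.toReal_mono (ENNReal.inv_ne_top.2 ?_) (ENNReal.inv_le_inv.2 hxB)
        exact fun h0 => by simp [h0] at hP
      have h2 : 1 / (p y).toReal ≤ (B₁⁻¹).toReal := by
        rw [← hinv]
        refine ENNReal.toReal_mono (ENNReal.inv_ne_top.2 ?_)
          (ENNReal.inv_le_inv.2 (hyinf hyB))
        exact (hp.essInf_pos.trans_le
          (essInf_antitone_measure Measure.restrict_le_self.absolutelyContinuous)).ne'
      have h3 := hC x r hr
      rw [hBm, ENNReal.ofReal_rpow_of_pos hm0] at h3
      -- As `m ≤ 1`, replacing `1/p(x) - 1/p(y)` by the smaller exponent `1/p_B⁺ - 1/p_B⁻` increases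
      -- the power.
      refine (Real.rpow_le_rpow_of_exponent_ge hm0 hm1 (sub_le_sub h1 h2)).trans ?_
      exact ((ENNReal.ofReal_le_iff_le_toReal hC₀.ne).1 h3).trans (le_max_right _ _)
    · rw [one_div, hA]
      refine mul_le_mul (le_add_of_nonneg_right (by positivity)) (by linarith) hm' (by positivity)
  · refine (rpow_le_of_ball_large ha hP hx.2.2 hy.2.1 hc hc1 hK'1 hm1.le hH0 hHK hW0 ?_).trans ?_
    · intro hPQ
      have hd : 0 < 1 / (p x).toReal - 1 / (p y).toReal :=
        sub_pos.2 (one_div_lt_one_div_of_lt hP hPQ)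
      have hde : 1 / (p x).toReal - 1 / (p y).toReal ≤ e x + e y := by
        rw [he, ← hinv, ← hinv]
        simp only
        rw [abs_sub_comm ((p y)⁻¹).toReal]
        exact (le_abs_self _).trans (abs_sub_le _ _ _)
      -- The point with the larger deviation is used: `w(y)` is bounded by Chebyshev, while `w(x)`
      -- is already part of the majorant.
      rcases le_total (e x) (e y) with hexy | hexy
      · have := (phi_inv_ofReal_one_le hc hc1 hd (e := e y) (by linarith)).trans hwy
        rw [ENNReal.ofReal_le_ofReal_iff hKm] at this
        linarith
      · have := phi_inv_ofReal_one_le hc hc1 hd (e := e x) (by linarith)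
        have := (ENNReal.ofReal_le_iff_le_toReal (hwfin x)).1 this
        linarith
    · calc K' ^ (b / a) * c ^ (-(2 * b)) * (W + 2 * (K' / m))
          ≤ K' ^ (b / a) * c ^ (-(2 * b)) * (2 * K' * (m⁻¹ + W)) := by
            gcongr
            rw [div_eq_mul_inv]
            nlinarith
        _ = K' ^ (b / a) * c ^ (-(2 * b)) * (2 * K') * (m⁻¹ + W) := by ring
        _ ≤ A * (m⁻¹ + W) := by
            gcongr
            exact le_add_of_nonneg_left hA1

end Domination

/-! ### Almost everywhere convergent subsequences -/

section AeConvergence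

/-- The density is a positive integrable function capped at 1. The cap lets integral bounds pass
from `μ` to `ν`; positivity lets a.e. statements return. -/
lemma exists_finite_withDensity {X : Type*} [MeasurableSpace X] (μ : Measure X) [SigmaFinite μ] :
    ∃ ν : Measure X, IsFiniteMeasure ν ∧ ν ≤ μ ∧ μ ≪ ν := by
  obtain ⟨g, hg0, hgm, hg⟩ := exists_pos_lintegral_lt_of_sigmaFinite μ one_ne_zero
  have hm : Measurable fun x => min (g x : ℝ≥0∞) 1 := hgm.coe_nnreal_ennreal.min measurable_const
  refine ⟨μ.withDensity fun x => min (g x : ℝ≥0∞) 1, ?_, ?_, ?_⟩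
  · refine isFiniteMeasure_withDensity (ne_of_lt ?_)
    exact (lintegral_mono fun x => min_le_left _ _).trans_lt (hg.trans ENNReal.one_lt_top)
  · refine Measure.le_iff.2 fun s hs => ?_
    rw [withDensity_apply _ hs]
    exact (lintegral_mono fun x => min_le_right _ _).trans_eq (by simp)
  · refine withDensity_absolutelyContinuous' hm.aemeasurable (Eventually.of_forall fun x => ?_)
    exact (lt_min (by simpa using hg0 x) one_pos).ne'

variable {X : Type*} [MeasurableSpace X]

lemma enorm_sub_integral_le {π : Measure X} [IsProbabilityMeasure π] {v : X → ℝ}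
    (hv : Integrable v π) {g : X → ℝ≥0∞} (c : ℝ) (g₀ : ℝ≥0∞)
    (h : ∀ᵐ y ∂π, ‖c - v y‖ₑ ≤ g₀ + g y) : ‖c - ∫ y, v y ∂π‖ₑ ≤ g₀ + ∫⁻ y, g y ∂π := by
  have h1 : c - ∫ y, v y ∂π = ∫ y, (c - v y) ∂π := by
    rw [integral_sub (integrable_const _) hv]; simp
  rw [h1]
  calc ‖∫ y, (c - v y) ∂π‖ₑ ≤ ∫⁻ y, ‖c - v y‖ₑ ∂π := enorm_integral_le_lintegral_enorm _
    _ ≤ ∫⁻ y, (g₀ + g y) ∂π := lintegral_mono_ae h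
    _ = _ := by rw [lintegral_add_left measurable_const]; simp

/-- The function `v` is close in `L¹(E)` to its average over `E`. -/
lemma setLIntegral_enorm_sub_average_le {ν : Measure X} [IsFiniteMeasure ν] {E : Set X}
    (hE : MeasurableSet E) {v : X → ℝ} (hv : Integrable v ν) {g : X → ℝ≥0∞}
    (hg : AEMeasurable g ν) {N : Set X} (hN : ν N = 0)
    (h : ∀ x ∈ E, ∀ y ∈ E, x ∉ N → y ∉ N → ‖v x - v y‖ₑ ≤ g x + g y) :
    ∫⁻ x in E, ‖v x - ⨍ y in E, v y ∂ν‖ₑ ∂ν ≤ 2 * ∫⁻ x in E, g x ∂ν := by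
  rcases eq_or_ne (ν E) 0 with h0 | h0
  · simp [Measure.restrict_eq_zero.2 h0]
  have : NeZero (ν.restrict E) := ⟨fun h => h0 (Measure.restrict_eq_zero.1 h)⟩
  have hNE : ∀ᵐ y ∂ν.restrict E, y ∈ E ∧ y ∉ N :=
    (ae_restrict_mem hE).and (ae_restrict_of_ae (measure_eq_zero_iff_ae_notMem.1 hN))
  have hpt : ∀ᵐ x ∂ν.restrict E,
      ‖v x - ⨍ y in E, v y ∂ν‖ₑ ≤ g x + (ν E)⁻¹ * ∫⁻ y in E, g y ∂ν := by
    filter_upwards [hNE] with x hx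
    have h1 : (ν E)⁻¹ * ∫⁻ y in E, g y ∂ν
        = ∫⁻ y, g y ∂(((ν.restrict E) univ)⁻¹ • ν.restrict E) := by
      rw [lintegral_smul_measure, Measure.restrict_apply_univ, smul_eq_mul]
    rw [h1, average]
    refine enorm_sub_integral_le ?_ _ _ ?_
    · exact hv.restrict.smul_measure (by simpa using h0)
    · exact (Measure.smul_absolutelyContinuous).ae_le
        (hNE.mono fun y hy => h x hx.1 y hy.1 hx.2 hy.2)
  calc ∫⁻ x in E, ‖v x - ⨍ y in E, v y ∂ν‖ₑ ∂ν
      ≤ ∫⁻ x in E, (g x + (ν E)⁻¹ * ∫⁻ y in E, g y ∂ν) ∂ν := lintegral_mono_ae hpt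
    _ = ∫⁻ x in E, g x ∂ν + (ν E)⁻¹ * (∫⁻ y in E, g y ∂ν) * ν E := by
        rw [lintegral_add_left' hg.restrict, setLIntegral_const]
    _ = ∫⁻ x in E, g x ∂ν + ∫⁻ x in E, g x ∂ν := by
        rw [mul_comm _ (ν E), ← mul_assoc, ENNReal.mul_inv_cancel h0 (measure_ne_top _ _), one_mul]
    _ = _ := (two_mul _).symm

/-- A countable measurable partition, given as the fibres of `κ`, into sets of diameter
less than `r`. -/
lemma exists_countable_partition [MetricSpace X] [BorelSpace X] [SecondCountableTopology X]
    {r : ℝ} (hr : 0 < r) :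
    ∃ κ : X → ℕ, Measurable κ ∧ ∀ x y, κ x = κ y → dist x y < r := by
  rcases isEmpty_or_nonempty X with hX | hX
  · exact ⟨fun _ => 0, measurable_const, fun x => hX.elim x⟩
  have hex : ∀ x : X, ∃ i, dist x (TopologicalSpace.denseSeq X i) < r / 2 := fun x => by
    have h := (TopologicalSpace.denseRange_denseSeq X).exists_dist_lt x (half_pos hr)
    exact h
  classical
  -- Each point is sent to the first member of a dense sequence within distance `r/2`.
  refine ⟨fun x => Nat.find (hex x), ?_, fun x y hxy => ?_⟩
  · refine measurable_find hex fun k => ?_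
    exact measurableSet_lt (measurable_id.dist measurable_const) measurable_const
  · have h1 := Nat.find_spec (hex x)
    have h2 := Nat.find_spec (hex y)
    simp only at hxy
    rw [← hxy] at h2
    have := dist_triangle_right x y (TopologicalSpace.denseSeq X (Nat.find (hex x)))
    linarith

lemma lintegral_enorm_sub_fiber_average_le {ν : Measure X} [IsFiniteMeasure ν] {κ : X → ℕ}
    (hκ : Measurable κ) {v : X → ℝ} (hv : Integrable v ν) {g : X → ℝ≥0∞}
    (hg : AEMeasurable g ν) {N : Set X} (hN : ν N = 0)
    (h : ∀ x y, κ x = κ y → x ∉ N → y ∉ N → ‖v x - v y‖ₑ ≤ g x + g y) :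
    ∫⁻ x, ‖v x - ⨍ y in κ ⁻¹' {κ x}, v y ∂ν‖ₑ ∂ν ≤ 2 * ∫⁻ x, g x ∂ν := by
  have hE : ∀ i, MeasurableSet (κ ⁻¹' {i}) := fun i => hκ (measurableSet_singleton i)
  have hd : Pairwise (Function.onFun Disjoint fun i => κ ⁻¹' {i}) := fun i j hij =>
    Disjoint.preimage _ (by simpa using hij)
  have hU : ⋃ i, κ ⁻¹' {i} = univ := eq_univ_of_forall fun x => mem_iUnion.2 ⟨κ x, rfl⟩
  have hsum : ∀ f : X → ℝ≥0∞, ∫⁻ x, f x ∂ν = ∑' i, ∫⁻ x in κ ⁻¹' {i}, f x ∂ν := fun f => by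
    rw [← lintegral_iUnion hE hd, hU, Measure.restrict_univ]
  rw [hsum, hsum, ← ENNReal.tsum_mul_left]
  refine ENNReal.tsum_le_tsum fun i => ?_
  have : ∫⁻ x in κ ⁻¹' {i}, ‖v x - ⨍ y in κ ⁻¹' {κ x}, v y ∂ν‖ₑ ∂ν
      = ∫⁻ x in κ ⁻¹' {i}, ‖v x - ⨍ y in κ ⁻¹' {i}, v y ∂ν‖ₑ ∂ν := by
    refine setLIntegral_congr_fun (hE i) fun x hx => ?_
    simp only [mem_preimage, mem_singleton_iff] at hx
    simp only [hx]
  rw [this]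
  refine setLIntegral_enorm_sub_average_le (hE i) hv hg hN fun x hx y hy => ?_
  refine h x y ?_
  simp only [mem_preimage, mem_singleton_iff] at hx hy
  rw [hx, hy]

lemma abs_average_le {ν : Measure X} {E : Set X} {v : X → ℝ} {c : ℝ} (hc : 0 ≤ c)
    (hE : ν E ≠ ∞) (hv : ∀ x, |v x| ≤ c) : |⨍ y in E, v y ∂ν| ≤ c := by
  have h1 : ‖∫ y in E, v y ∂ν‖ ≤ c * ν.real E :=
    norm_setIntegral_le_of_norm_le_const hE.lt_top fun x _ => hv x
  rw [setAverage_eq, smul_eq_mul, abs_mul, abs_inv, abs_of_nonneg measureReal_nonneg,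
    inv_mul_eq_div]
  exact div_le_of_le_mul₀ measureReal_nonneg hc h1

/-- There may be infinitely many cells, without uniform convergence over them; dominated convergence
with a constant majorant suffices on a finite measure. -/
lemma tendsto_lintegral_enorm_sub_comp_of_bounded {ν : Measure X} [IsFiniteMeasure ν] {κ : X → ℕ}
    (hκ : Measurable κ) {A : ℕ → ℕ → ℝ} {α : ℕ → ℝ} {c : ℝ} (hA : ∀ n i, |A n i| ≤ c)
    (hlim : ∀ i, Tendsto (fun n => A n i) atTop (𝓝 (α i))) :
    Tendsto (fun n => ∫⁻ x, ‖A n (κ x) - α (κ x)‖ₑ ∂ν) atTop (𝓝 0) := by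
  have hα : ∀ i, |α i| ≤ c := fun i =>
    le_of_tendsto (hlim i).abs (Eventually.of_forall fun n => hA n i)
  have hm : ∀ n, Measurable fun x => ‖A n (κ x) - α (κ x)‖ₑ := fun n =>
    (measurable_from_nat (f := fun i => ‖A n i - α i‖ₑ)).comp hκ
  have := tendsto_lintegral_of_dominated_convergence' (μ := ν)
    (F := fun n x => ‖A n (κ x) - α (κ x)‖ₑ) (f := fun _ => (0 : ℝ≥0∞))
    (fun _ => ENNReal.ofReal (c + c)) (fun n => (hm n).aemeasurable)
    (fun n => Eventually.of_forall fun x => ?_)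
    (by rw [lintegral_const]; exact ENNReal.mul_ne_top ENNReal.ofReal_ne_top (measure_ne_top _ _))
    (Eventually.of_forall fun x => ?_)
  · simpa using this
  · simp only
    rw [Real.enorm_eq_ofReal_abs]
    exact ENNReal.ofReal_le_ofReal ((abs_sub _ _).trans (add_le_add (hA n _) (hα _)))
  · simpa using ((hlim (κ x)).sub_const (α (κ x))).enorm

/-- Compactness in `L¹` of a finite measure for bounded functions with small increments. -/
lemma exists_subseq_tendsto_ae_of_bounded [MetricSpace X] [BorelSpace X] [SecondCountableTopology X]
    {ν : Measure X} [IsFiniteMeasure ν] {v : ℕ → X → ℝ} (hvm : ∀ n, AEMeasurable (v n) ν)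
    (hv2 : ∀ n x, |v n x| ≤ 2)
    (h : ∀ ε : ℝ≥0∞, ε ≠ 0 → ∃ r : ℝ, 0 < r ∧ ∀ n, ∃ g : X → ℝ≥0∞, AEMeasurable g ν ∧
      ∫⁻ x, g x ∂ν ≤ ε ∧ ∃ N : Set X, ν N = 0 ∧
        ∀ x y, x ∉ N → y ∉ N → dist x y < r → ‖v n x - v n y‖ₑ ≤ g x + g y) :
    ∃ (i : ℕ → ℕ) (f : X → ℝ), StrictMono i ∧ Measurable f ∧
      ∀ᵐ x ∂ν, Tendsto (fun n => v (i n) x) atTop (𝓝 (f x)) := by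
  have hr : ∀ m : ℕ, (0 : ℝ) < 1 / (m + 1) := fun m => by positivity
  choose κ hκm hκ using fun m => exists_countable_partition (X := X) (hr m)
  set A : ℕ → ℕ × ℕ → ℝ := fun n z => ⨍ y in κ z.1 ⁻¹' {z.2}, v n y ∂ν with hA
  have hA2 : ∀ n z, |A n z| ≤ 2 := fun n z => abs_average_le two_pos.le (measure_ne_top _ _) (hv2 n)
  -- Compactness of the countable product of intervals `[-2, 2]` replaces a diagonal argument: the
  -- averages over all cells at all scales converge along one subsequence.
  obtain ⟨α, -, φ, hφ, hlim⟩ := (isCompact_univ_pi fun _ : ℕ × ℕ =>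
    isCompact_Icc (a := (-2 : ℝ)) (b := 2)).tendsto_subseq (x := A)
      (fun n z _ => abs_le.1 (hA2 n z))
  rw [tendsto_pi_nhds] at hlim
  have hvi : ∀ n, Integrable (v n) ν := fun n =>
    Integrable.of_bound (hvm n).aestronglyMeasurable 2 (Eventually.of_forall (hv2 n))
  have hmem : ∀ n, MemLp (v n) 1 ν := fun n => memLp_one_iff_integrable.2 (hvi n)
  have hAm : ∀ (β : ℕ × ℕ → ℝ) m, Measurable fun x => β (m, κ m x) := fun β m =>
    (measurable_from_nat (f := fun i => β (m, i))).comp (hκm m)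
  have hAlim : ∀ m, Tendsto (fun n => ∫⁻ x, ‖A (φ n) (m, κ m x) - α (m, κ m x)‖ₑ ∂ν)
      atTop (𝓝 0) := by
    intro m
    exact tendsto_lintegral_enorm_sub_comp_of_bounded (hκm m)
      (A := fun n i => A (φ n) (m, i)) (α := fun i => α (m, i)) (fun n i => hA2 _ _)
      fun i => hlim (m, i)
  have hcauchy : CauchySeq fun n => (hmem (φ n)).toLp (v (φ n)) := by
    rw [EMetric.cauchySeq_iff]
    intro ε hε
    -- Each function is within 3 units of the limiting step function (2 from the oscillation, 1 from
    -- the averages), two functions within 6; the seventh makes the inequality strict.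
    have hε' : ε / 7 ≠ 0 := (ENNReal.div_pos hε.ne' (by simp)).ne'
    obtain ⟨r, hr0, hrg⟩ := h (ε / 7) hε'
    obtain ⟨m, hm⟩ := exists_nat_one_div_lt hr0
    have hclose : ∀ n, ∫⁻ x, ‖v n x - A n (m, κ m x)‖ₑ ∂ν ≤ 2 * (ε / 7) := by
      intro n
      obtain ⟨g, hgm, hgε, N, hN, hg⟩ := hrg n
      refine (lintegral_enorm_sub_fiber_average_le (hκm m) (hvi n) hgm hN
        fun x y hxy hx hy => hg x y hx hy ((hκ m x y hxy).trans hm)).trans ?_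
      gcongr
    obtain ⟨M, hM⟩ := eventually_atTop.1
      (ENNReal.tendsto_nhds_zero.1 (hAlim m) (ε / 7) (pos_iff_ne_zero.2 hε'))
    have hclose' : ∀ n ≥ M, ∫⁻ x, ‖v (φ n) x - α (m, κ m x)‖ₑ ∂ν ≤ 3 * (ε / 7) := by
      intro n hn
      calc ∫⁻ x, ‖v (φ n) x - α (m, κ m x)‖ₑ ∂ν
          ≤ ∫⁻ x, (‖v (φ n) x - A (φ n) (m, κ m x)‖ₑ
              + ‖A (φ n) (m, κ m x) - α (m, κ m x)‖ₑ) ∂ν := by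
            refine lintegral_mono fun x => ?_
            refine le_trans (le_of_eq ?_) (enorm_add_le _ _)
            rw [sub_add_sub_cancel]
        _ = _ := lintegral_add_right _ ((hAm (A (φ n)) m).sub (hAm α m)).enorm
        _ ≤ 2 * (ε / 7) + ε / 7 := add_le_add (hclose _) (hM n hn)
        _ = 3 * (ε / 7) := by ring
    by_cases hεt : ε = ∞
    · refine ⟨0, fun n _ l _ => ?_⟩
      rw [hεt]; exact edist_lt_top _ _
    refine ⟨M, fun n hn l hl => ?_⟩
    rw [Lp.edist_toLp_toLp, eLpNorm_one_eq_lintegral_enorm]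
    calc ∫⁻ x, ‖(v (φ n) - v (φ l)) x‖ₑ ∂ν
        ≤ ∫⁻ x, (‖v (φ n) x - α (m, κ m x)‖ₑ + ‖v (φ l) x - α (m, κ m x)‖ₑ) ∂ν := by
          refine lintegral_mono fun x => ?_
          refine le_trans (le_of_eq ?_) (enorm_sub_le)
          rw [sub_sub_sub_cancel_right, Pi.sub_apply]
      _ = _ := lintegral_add_left' ((hvm _).sub (hAm α m).aemeasurable).enorm _
      _ ≤ 3 * (ε / 7) + 3 * (ε / 7) := add_le_add (hclose' n hn) (hclose' l hl)
      _ = 6 * (ε / 7) := by ring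
      _ < 7 * (ε / 7) :=
          (ENNReal.mul_lt_mul_iff_left hε' (ENNReal.div_ne_top hεt (by simp))).2 (by norm_num)
      _ = ε := ENNReal.mul_div_cancel (by simp) (by simp)
  obtain ⟨F, hF⟩ := cauchySeq_tendsto_of_complete hcauchy
  obtain ⟨ψ, hψ, hae⟩ := (tendstoInMeasure_of_tendsto_Lp hF).exists_seq_tendsto_ae
  refine ⟨φ ∘ ψ, F, hφ.comp hψ, (Lp.stronglyMeasurable F).measurable, ?_⟩
  have hall : ∀ᵐ x ∂ν, ∀ n, ((hmem (φ n)).toLp (v (φ n))) x = v (φ n) x :=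
    ae_all_iff.2 fun n => (hmem (φ n)).coeFn_toLp
  filter_upwards [hae, hall] with x hx hx'
  simpa only [hx', Function.comp] using hx

end AeConvergence

/-! ### Compactness -/

section Compactness

lemma enorm_arctan_sub_le (x y : ℝ) : ‖Real.arctan x - Real.arctan y‖ₑ ≤ ‖x - y‖ₑ := by
  have h : LipschitzWith 1 Real.arctan := by
    refine lipschitzWith_of_nnnorm_deriv_le Real.differentiable_arctan fun z => ?_
    rw [Real.deriv_arctan, ← NNReal.coe_le_coe, coe_nnnorm, Real.norm_of_nonneg (by positivity),
      NNReal.coe_one, div_le_one (by positivity)]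
    nlinarith [sq_nonneg z]
  have := h x y
  rwa [ENNReal.coe_one, one_mul, edist_eq_enorm_sub, edist_eq_enorm_sub] at this

lemma abs_arctan_le_two (x : ℝ) : |Real.arctan x| ≤ 2 := by
  rw [abs_le]
  constructor <;> linarith [Real.arctan_lt_pi_div_two x, Real.neg_pi_div_two_lt_arctan x,
    Real.pi_le_four]

/-- A finite lower limit means `|t n| ≤ R` infinitely often, so `z` lies in `[-arctan R, arctan R]`,
where the tangent is continuous. -/
lemma tendsto_tan_of_tendsto_arctan {t : ℕ → ℝ} {z P : ℝ} (hP : 0 < P)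
    (ht : Tendsto (fun n => Real.arctan (t n)) atTop (𝓝 z))
    (hlim : liminf (fun n => ‖t n‖ₑ ^ P) atTop < ∞) :
    Tendsto t atTop (𝓝 (Real.tan z)) := by
  obtain ⟨c, hc, hct⟩ := exists_between hlim
  have hfreq := frequently_lt_of_liminf_lt (by isBoundedDefault) hc
  set R : ℝ := (c ^ P⁻¹).toReal with hR
  have hcP : c ^ P⁻¹ ≠ ∞ := ENNReal.rpow_ne_top_of_nonneg (by positivity) hct.ne
  have hz : z ∈ Icc (-Real.arctan R) (Real.arctan R) := by
    refine isClosed_Icc.mem_of_frequently_of_tendsto (hfreq.mono fun n hn => ?_) ht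
    have h1 : ‖t n‖ₑ ≤ c ^ P⁻¹ := (ENNReal.le_rpow_inv_iff hP).2 hn.le
    have h2 : |t n| ≤ R := by
      rw [Real.enorm_eq_ofReal_abs, ENNReal.ofReal_le_iff_le_toReal hcP] at h1
      exact h1
    rw [← Real.arctan_neg]
    exact ⟨Real.arctan_strictMono.monotone (abs_le.1 h2).1,
      Real.arctan_strictMono.monotone (abs_le.1 h2).2⟩
  have hcos : 0 < Real.cos z := by
    refine Real.cos_pos_of_mem_Ioo ⟨?_, ?_⟩ <;>
      linarith [hz.1, hz.2, Real.arctan_lt_pi_div_two R]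
  have := (Real.continuousAt_tan.2 hcos.ne').tendsto.comp ht
  simpa only [Function.comp_def, Real.tan_arctan] using this

lemma ae_liminf_lt_top {X : Type*} [MeasurableSpace X] {μ : Measure X} {f : ℕ → X → ℝ≥0∞}
    (hf : ∀ n, AEMeasurable (f n) μ) {K : ℝ≥0∞} (hK : K ≠ ∞) (h : ∀ n, ∫⁻ x, f n x ∂μ ≤ K) :
    ∀ᵐ x ∂μ, liminf (fun n => f n x) atTop < ∞ := by
  have hall : ∀ᵐ x ∂μ, ∀ n, f n x = (hf n).mk _ x := ae_all_iff.2 fun n => (hf n).ae_eq_mk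
  have h1 : ∫⁻ x, liminf (fun n => (hf n).mk _ x) atTop ∂μ ≤ K := by
    refine (lintegral_liminf_le fun n => (hf n).measurable_mk).trans ?_
    refine liminf_le_of_le (by isBoundedDefault) fun b hb => ?_
    obtain ⟨n, hn⟩ := hb.exists
    exact hn.trans ((lintegral_congr_ae (hf n).ae_eq_mk).symm.le.trans (h n))
  filter_upwards [hall, ae_lt_top (Measurable.liminf fun n => (hf n).measurable_mk)
    (h1.trans_lt hK.lt_top).ne] with x hx hx'
  simpa only [hx] using hx'

/-- Converts small modular into small `L¹` norm after truncation: if `G > δ`, then `δ^b ≤ δ^P ≤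
G^P`. The level 4 bounds the difference of two arctangents, each bounded by 2. -/
lemma min_le_add_rpow {δ G : ℝ≥0∞} {P b : ℝ} (hδ : δ ≠ 0) (hδ1 : δ ≤ 1) (hP : 0 ≤ P)
    (hPb : P ≤ b) : min 4 G ≤ δ + 4 * (δ ^ b)⁻¹ * G ^ P := by
  rcases le_or_gt G δ with h | h
  · exact (min_le_right _ _).trans (h.trans le_self_add)
  · have h1 : δ ^ b ≤ G ^ P := (ENNReal.rpow_le_rpow_of_exponent_ge hδ1 hPb).trans
      (ENNReal.rpow_le_rpow h.le hP)
    have hδt : δ ≠ ∞ := (hδ1.trans_lt ENNReal.one_lt_top).ne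
    have h2 : 1 ≤ (δ ^ b)⁻¹ * G ^ P := by
      rw [← ENNReal.inv_mul_cancel (ENNReal.rpow_pos (pos_iff_ne_zero.2 hδ) hδt).ne'
        (ENNReal.rpow_ne_top_of_nonneg (hP.trans hPb) hδt)]
      gcongr
    calc min 4 G ≤ 4 * 1 := by rw [mul_one]; exact min_le_left _ _
      _ ≤ 4 * ((δ ^ b)⁻¹ * G ^ P) := by gcongr
      _ = 4 * (δ ^ b)⁻¹ * G ^ P := (mul_assoc _ _ _).symm
      _ ≤ _ := le_add_self

variable {X : Type*} [MeasurableSpace X] {μ : Measure X} {p : X → ℝ≥0∞} {u : ℕ → X → ℝ}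
  {K : ℝ≥0∞}

lemma lintegral_rpow_limit_le (hp : IsBoundedExponent p μ) {v : X → ℝ}
    (hu : ∀ n, AEMeasurable (u n) μ) (huK : ∀ n, ∫⁻ x, ‖u n x‖ₑ ^ (p x).toReal ∂μ ≤ K)
    (hlim : ∀ᵐ x ∂μ, Tendsto (fun n => u n x) atTop (𝓝 (v x))) :
    ∫⁻ x, ‖v x‖ₑ ^ (p x).toReal ∂μ ≤ K := by
  calc ∫⁻ x, ‖v x‖ₑ ^ (p x).toReal ∂μ
      = ∫⁻ x, liminf (fun n => ‖u n x‖ₑ ^ (p x).toReal) atTop ∂μ := by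
        refine lintegral_congr_ae (hlim.mono fun x hx => ?_)
        exact (((ENNReal.continuous_rpow_const.tendsto _).comp hx.enorm).liminf_eq).symm
    _ ≤ liminf (fun n => ∫⁻ x, ‖u n x‖ₑ ^ (p x).toReal ∂μ) atTop :=
        lintegral_liminf_le' fun n => (hu n).enorm.pow
          hp.measurable.ennreal_toReal.aemeasurable
    _ ≤ K := by
        refine liminf_le_of_le (by isBoundedDefault) fun b hb => ?_
        obtain ⟨n, hn⟩ := hb.exists
        exact hn.trans (huK n)

variable [MetricSpace X]

/-- The value at `x` is compared with that at a dominated point `y` of the ball: `|f(x)| ≤ G(x) +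
(|f(y)| + G(y))`. Such `y` form a set of positive measure, so one avoids `N`. -/
lemma ae_rpow_le_of_locallyDominated {a b : ℝ}
    (hab : ∀ᵐ x ∂μ, p x ≠ ∞ ∧ a ≤ (p x).toReal ∧ (p x).toReal ≤ b) {r : ℝ}
    {f : X → ℝ} {G Φ : X → ℝ≥0∞} {N : Set X} (hN : μ N = 0)
    (hG : ∀ x y, x ∉ N → y ∉ N → dist x y < r → ‖f x - f y‖ₑ ≤ G x + G y)
    (hΦ : ∀ᵐ x ∂μ, 0 < μ {y | y ∈ Metric.ball x r ∧ (‖f y‖ₑ + G y) ^ (p x).toReal ≤ Φ x}) :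
    ∀ᵐ x ∂μ, ‖f x‖ₑ ^ (p x).toReal ≤ 2 ^ b * (G x ^ (p x).toReal + Φ x) := by
  filter_upwards [hab, hΦ, measure_eq_zero_iff_ae_notMem.1 hN] with x hx hxΦ hxN
  obtain ⟨y, hyS, hyN⟩ : ∃ y, y ∈ {y | y ∈ Metric.ball x r ∧
      (‖f y‖ₑ + G y) ^ (p x).toReal ≤ Φ x} ∧ y ∉ N := by
    by_contra! hcon
    exact hxΦ.ne' (measure_mono_null hcon hN)
  have h1 : ‖f x‖ₑ ≤ G x + (‖f y‖ₑ + G y) := by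
    calc ‖f x‖ₑ = ‖(f x - f y) + f y‖ₑ := by rw [sub_add_cancel]
      _ ≤ ‖f x - f y‖ₑ + ‖f y‖ₑ := enorm_add_le _ _
      _ ≤ (G x + G y) + ‖f y‖ₑ := by
          gcongr
          exact hG x y hxN hyN (by rw [dist_comm]; exact hyS.1)
      _ = _ := by ring
  calc ‖f x‖ₑ ^ (p x).toReal ≤ (G x + (‖f y‖ₑ + G y)) ^ (p x).toReal :=
        ENNReal.rpow_le_rpow h1 ENNReal.toReal_nonneg
    _ ≤ 2 ^ b * (G x ^ (p x).toReal + (‖f y‖ₑ + G y) ^ (p x).toReal) :=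
        ennreal_add_rpow_le ENNReal.toReal_nonneg hx.2.2 _ _
    _ ≤ _ := by gcongr; exact hyS.2

/-- Outside a multiple of `G^p`, which has small integral but depends on `n`, the integrand is below
a fixed integrable `Ψ`. Dominated convergence is therefore applied to the minimum of the integrand
and `Ψ`. -/
lemma tendsto_lintegral_rpow_sub (hp : IsBoundedExponent p μ) (hdom : LocallyDominated p μ)
    (hu : ∀ n, AEMeasurable (u n) μ) (hK : K ≠ ∞)
    (huK : ∀ n, ∫⁻ x, ‖u n x‖ₑ ^ (p x).toReal ∂μ ≤ K) (hinc : SmallIncrements p μ u)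
    {v : X → ℝ} (hv : AEMeasurable v μ)
    (hlim : ∀ᵐ x ∂μ, Tendsto (fun n => u n x) atTop (𝓝 (v x))) :
    Tendsto (fun n => ∫⁻ x, ‖u n x - v x‖ₑ ^ (p x).toReal ∂μ) atTop (𝓝 0) := by
  obtain ⟨a, b, ha, hb, hab⟩ := hp.exists_bounds
  have hpm : AEMeasurable (fun x => (p x).toReal) μ := hp.measurable.ennreal_toReal.aemeasurable
  have h2b : (2 : ℝ≥0∞) ^ b ≠ ∞ := ENNReal.rpow_ne_top_of_nonneg hb.le (by simp)
  have h2b0 : (2 : ℝ≥0∞) ^ b ≠ 0 := (ENNReal.rpow_pos (by simp) (by simp)).ne'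
  set c : ℝ≥0∞ := 2 ^ b * 2 ^ b with hc
  have hct : c ≠ ∞ := ENNReal.mul_ne_top h2b h2b
  have hc0 : c ≠ 0 := mul_ne_zero h2b0 h2b0
  have hvK := lintegral_rpow_limit_le hp hu huK hlim
  rw [ENNReal.tendsto_nhds_zero]
  intro ε hε
  have hε2 : ε / 2 ≠ 0 := (ENNReal.div_pos hε.ne' (by simp)).ne'
  -- The bound 1 keeps the modular of `|u n| + G` below a constant independent of `ε`; the other
  -- bound makes the `G` term contribute at most `ε/2`.
  set η : ℝ≥0∞ := min 1 (ε / 2 / c) with hη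
  obtain ⟨r, hr, hrG⟩ := hinc η (lt_min one_pos (ENNReal.div_pos hε2 hct)).ne'
  obtain ⟨Φ, hΦm, hΦi, hΦ⟩ := hdom r hr (2 ^ b * (K + 1))
    (ENNReal.mul_ne_top h2b (by simpa using hK))
  set Ψ : X → ℝ≥0∞ := fun x => c * Φ x + 2 ^ b * ‖v x‖ₑ ^ (p x).toReal with hΨ
  have hvm : AEMeasurable (fun x => ‖v x‖ₑ ^ (p x).toReal) μ := hv.enorm.pow hpm
  have hΨm : AEMeasurable Ψ μ := (hΦm.aemeasurable.const_mul _).add (hvm.const_mul _)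
  have hΨi : ∫⁻ x, Ψ x ∂μ ≠ ∞ := by
    rw [hΨ, lintegral_add_left (hΦm.const_mul _), lintegral_const_mul' _ _ hct,
      lintegral_const_mul' _ _ h2b]
    exact ENNReal.add_ne_top.2 ⟨ENNReal.mul_ne_top hct hΦi,
      ENNReal.mul_ne_top h2b (hvK.trans_lt hK.lt_top).ne⟩
  have hdiff : ∀ n, AEMeasurable (fun x => ‖u n x - v x‖ₑ ^ (p x).toReal) μ := fun n =>
    ((hu n).sub hv).enorm.pow hpm
  have hmin : Tendsto (fun n => ∫⁻ x, min (‖u n x - v x‖ₑ ^ (p x).toReal) (Ψ x) ∂μ)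
      atTop (𝓝 0) := by
    have := tendsto_lintegral_of_dominated_convergence' (μ := μ)
      (F := fun n x => min (‖u n x - v x‖ₑ ^ (p x).toReal) (Ψ x)) (f := fun _ => (0 : ℝ≥0∞)) Ψ
      (fun n => (hdiff n).min hΨm) (fun n => Eventually.of_forall fun x => min_le_right _ _) hΨi ?_
    · simpa using this
    · filter_upwards [hlim, hab] with x hx hx'
      have h1 : Tendsto (fun n => ‖u n x - v x‖ₑ ^ (p x).toReal) atTop (𝓝 0) := by
        have h0 := (hx.sub_const (v x)).enorm
        have := (ENNReal.continuous_rpow_const (y := (p x).toReal)).tendsto _ |>.comp h0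
        simpa [Function.comp_def, ENNReal.zero_rpow_of_pos (ha.trans_le hx'.2.1)] using this
      exact tendsto_of_tendsto_of_tendsto_of_le_of_le tendsto_const_nhds h1
        (fun n => zero_le) fun n => min_le_left _ _
  filter_upwards [ENNReal.tendsto_nhds_zero.1 hmin (ε / 2) (pos_iff_ne_zero.2 hε2)] with n hn
  obtain ⟨G, hGm, hGη, N, hN, hG⟩ := hrG n
  have hGp : AEMeasurable (fun x => G x ^ (p x).toReal) μ := hGm.pow hpm
  have hsum : ∫⁻ x, (‖u n x‖ₑ + G x) ^ (p x).toReal ∂μ ≤ 2 ^ b * (K + 1) := by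
    calc ∫⁻ x, (‖u n x‖ₑ + G x) ^ (p x).toReal ∂μ
        ≤ ∫⁻ x, 2 ^ b * (‖u n x‖ₑ ^ (p x).toReal + G x ^ (p x).toReal) ∂μ := by
          refine lintegral_mono_ae (hab.mono fun x hx => ?_)
          exact ennreal_add_rpow_le ENNReal.toReal_nonneg hx.2.2 _ _
      _ = 2 ^ b * (∫⁻ x, ‖u n x‖ₑ ^ (p x).toReal ∂μ + ∫⁻ x, G x ^ (p x).toReal ∂μ) := by
          rw [lintegral_const_mul' _ _ h2b, lintegral_add_right' _ hGp]
      _ ≤ 2 ^ b * (K + 1) := by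
          gcongr
          · exact huK n
          · exact hGη.trans (min_le_left _ _)
  have hbound := ae_rpow_le_of_locallyDominated hab hN hG
    (hΦ (fun x => ‖u n x‖ₑ + G x) ((hu n).enorm.add hGm) hsum)
  calc ∫⁻ x, ‖u n x - v x‖ₑ ^ (p x).toReal ∂μ
      ≤ ∫⁻ x, (c * G x ^ (p x).toReal + min (‖u n x - v x‖ₑ ^ (p x).toReal) (Ψ x)) ∂μ := by
        refine lintegral_mono_ae ?_
        filter_upwards [hbound, hab] with x hx hx'
        rcases le_total (‖u n x - v x‖ₑ ^ (p x).toReal) (Ψ x) with h | h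
        · rw [min_eq_left h]; exact le_add_self
        · rw [min_eq_right h]
          calc ‖u n x - v x‖ₑ ^ (p x).toReal ≤ (‖u n x‖ₑ + ‖v x‖ₑ) ^ (p x).toReal :=
                ENNReal.rpow_le_rpow enorm_sub_le ENNReal.toReal_nonneg
            _ ≤ 2 ^ b * (‖u n x‖ₑ ^ (p x).toReal + ‖v x‖ₑ ^ (p x).toReal) :=
                ennreal_add_rpow_le ENNReal.toReal_nonneg hx'.2.2 _ _
            _ ≤ 2 ^ b * (2 ^ b * (G x ^ (p x).toReal + Φ x) + ‖v x‖ₑ ^ (p x).toReal) := by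
                gcongr
            _ = _ := by rw [hΨ, hc]; ring
    _ = c * ∫⁻ x, G x ^ (p x).toReal ∂μ
          + ∫⁻ x, min (‖u n x - v x‖ₑ ^ (p x).toReal) (Ψ x) ∂μ := by
        rw [lintegral_add_left' (hGp.const_mul c), lintegral_const_mul' _ _ hct]
    _ ≤ c * (ε / 2 / c) + ε / 2 := by
        gcongr
        exact hGη.trans (min_le_right _ _)
    _ ≤ ε / 2 + ε / 2 := by gcongr; exact ENNReal.mul_div_le
    _ = ε := ENNReal.add_halves ε

lemma SmallIncrements.subseq (h : SmallIncrements p μ u) (i : ℕ → ℕ) :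
    SmallIncrements p μ fun n => u (i n) := fun ε hε => by
  obtain ⟨r, hr, hG⟩ := h ε hε
  exact ⟨r, hr, fun n => hG (i n)⟩

variable [BorelSpace X]

lemma exists_subseq_tendsto_ae (hμ : BallsPosFinite μ) (hp : IsBoundedExponent p μ)
    (hu : ∀ n, AEMeasurable (u n) μ) (hK : K ≠ ∞)
    (huK : ∀ n, ∫⁻ x, ‖u n x‖ₑ ^ (p x).toReal ∂μ ≤ K) (hinc : SmallIncrements p μ u) :
    ∃ (i : ℕ → ℕ) (v : X → ℝ), StrictMono i ∧ AEMeasurable v μ ∧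
      ∀ᵐ x ∂μ, Tendsto (fun n => u (i n) x) atTop (𝓝 (v x)) := by
  have := hμ.sigmaFinite
  have := hμ.secondCountableTopology
  obtain ⟨a, b, ha, hb, hab⟩ := hp.exists_bounds
  obtain ⟨ν, hν, hνμ, hμν⟩ := exists_finite_withDensity μ
  have hνac : ν ≪ μ := Measure.absolutelyContinuous_of_le hνμ
  obtain ⟨i, f, hi, hfm, hf⟩ := exists_subseq_tendsto_ae_of_bounded (ν := ν)
    (v := fun n x => Real.arctan (u n x))
    (fun n => Real.measurable_arctan.comp_aemeasurable ((hu n).mono_ac hνac))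
    (fun n x => abs_arctan_le_two _) (by
      intro ε hε
      -- The part where `G ≤ δ` contributes at most `δ ν(X) ≤ ε/2`; the rest is controlled by the
      -- modular of `G`.
      set δ : ℝ≥0∞ := min 1 (ε / 2 / ν univ) with hδ
      have hε2 : ε / 2 ≠ 0 := (ENNReal.div_pos hε (by simp)).ne'
      have hδ0 : δ ≠ 0 := (lt_min one_pos (ENNReal.div_pos hε2 (measure_ne_top _ _))).ne'
      have hδ1 : δ ≤ 1 := min_le_left _ _
      have hδν : δ * ν univ ≤ ε / 2 := by
        calc δ * ν univ ≤ ε / 2 / ν univ * ν univ := by gcongr; exact min_le_right _ _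
          _ ≤ ε / 2 := by rw [mul_comm]; exact ENNReal.mul_div_le
      set M : ℝ≥0∞ := 4 * (δ ^ b)⁻¹ with hM
      have hMt : M ≠ ∞ := ENNReal.mul_ne_top (by simp) (ENNReal.inv_ne_top.2
        (ENNReal.rpow_pos (pos_iff_ne_zero.2 hδ0) (hδ1.trans_lt ENNReal.one_lt_top).ne).ne')
      obtain ⟨r, hr, hrG⟩ := hinc (ε / 2 / M) (ENNReal.div_pos hε2 hMt).ne'
      refine ⟨r, hr, fun n => ?_⟩
      obtain ⟨G, hG, hGε, N, hN, hGN⟩ := hrG n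
      refine ⟨fun x => min 4 (G x), aemeasurable_const.min (hG.mono_ac hνac), ?_, N, hνac hN,
        fun x y hx hy hxy => ?_⟩
      · calc ∫⁻ x, min 4 (G x) ∂ν ≤ ∫⁻ x, (δ + M * G x ^ (p x).toReal) ∂ν := by
              refine lintegral_mono_ae ?_
              filter_upwards [hνac.ae_le hab] with x hx
              exact min_le_add_rpow hδ0 hδ1 ENNReal.toReal_nonneg hx.2.2
          _ = δ * ν univ + M * ∫⁻ x, G x ^ (p x).toReal ∂ν := by
              rw [lintegral_add_left measurable_const, lintegral_const,
                lintegral_const_mul' _ _ hMt]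
          _ ≤ ε / 2 + M * (ε / 2 / M) := by
              gcongr
              exact (lintegral_mono' hνμ le_rfl).trans hGε
          _ ≤ ε / 2 + ε / 2 := by gcongr; exact ENNReal.mul_div_le
          _ = ε := ENNReal.add_halves ε
      · have h1 : ‖Real.arctan (u n x) - Real.arctan (u n y)‖ₑ ≤ G x + G y :=
          (enorm_arctan_sub_le _ _).trans (hGN x y hx hy hxy)
        have h2 : ‖Real.arctan (u n x) - Real.arctan (u n y)‖ₑ ≤ 4 := by
          rw [Real.enorm_eq_ofReal_abs, ENNReal.ofReal_le_iff_le_toReal (by simp)]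
          refine (abs_sub _ _).trans ?_
          have := abs_arctan_le_two (u n x)
          have := abs_arctan_le_two (u n y)
          norm_num
          linarith
        simp only
        rcases le_total 4 (G x) with h | h
        · rw [min_eq_left h]; exact h2.trans le_self_add
        rcases le_total 4 (G y) with h' | h'
        · rw [min_eq_left h']; exact h2.trans le_add_self
        rwa [min_eq_right h, min_eq_right h'])
  have hlim : ∀ᵐ x ∂μ, Tendsto (fun n => u (i n) x) atTop (𝓝 (Real.tan (f x))) := by
    filter_upwards [hμν.ae_le hf, hab, ae_liminf_lt_top (fun n => ((hu (i n)).enorm).pow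
      hp.measurable.ennreal_toReal.aemeasurable) hK (fun n => huK (i n))] with x hx hx' hx''
    exact tendsto_tan_of_tendsto_arctan (ha.trans_le hx'.2.1) hx hx''
  exact ⟨i, fun x => Real.tan (f x), hi,
    aemeasurable_of_tendsto_metrizable_ae atTop (fun n => hu (i n)) hlim, hlim⟩

/-- Bounded sequences with small increments are relatively compact in `L^{p(·)}`. -/
lemma exists_subseq_tendsto_lpNorm (hμ : BallsPosFinite μ) (hp : IsBoundedExponent p μ)
    (hdom : LocallyDominated p μ) (hu : ∀ n, AEMeasurable (u n) μ) (hK : K ≠ ∞)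
    (huK : ∀ n, ∫⁻ x, ‖u n x‖ₑ ^ (p x).toReal ∂μ ≤ K) (hinc : SmallIncrements p μ u) :
    ∃ v ∈ LpSpace p μ, ∃ i : ℕ → ℕ, StrictMono i ∧
      Tendsto (fun n => lpNorm p μ (fun x => u (i n) x - v x)) atTop (𝓝 0) := by
  obtain ⟨a, b, -, -, hab⟩ := hp.exists_bounds
  obtain ⟨i, v, hi, hv, hlim⟩ := exists_subseq_tendsto_ae hμ hp hu hK huK hinc
  refine ⟨v, ⟨hv, 1, one_pos, ENNReal.one_lt_top, ?_⟩, i, hi, ?_⟩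
  · simp only [one_mul]
    rw [modular_eq_lintegral (hab.mono fun x hx => hx.1)]
    exact (lintegral_rpow_limit_le hp (fun n => hu (i n)) (fun n => huK (i n)) hlim).trans_lt
      hK.lt_top
  · exact tendsto_lpNorm_zero (hab.mono fun x hx => ⟨hx.1, hx.2.2⟩)
      (tendsto_lintegral_rpow_sub hp hdom (fun n => hu (i n)) hK (fun n => huK (i n))
        (hinc.subseq i) hv hlim)

/-- Compact embedding of a space defined by a seminorm which bounds vector gradients. -/
lemma compactlyEmbedded_of_gradientBound {s : X → ℝ≥0∞} (hμ : BallsPosFinite μ)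
    (hp : IsBoundedExponent p μ) (hs : IsBoundedExponent s μ) (hdom : LocallyDominated p μ)
    {S : (X → ℝ) → ℝ≥0∞}
    (hS : ∀ (u : ℕ → X → ℝ) (C : ℝ≥0), (∀ n, S (u n) ≤ C) →
      ∃ K : ℝ≥0∞, K ≠ ∞ ∧ GradientBound s p μ u K) :
    CompactlyEmbedded {u | u ∈ LpSpace p μ ∧ S u < ∞} (fun u => lpNorm p μ u + S u)
      (LpSpace p μ) (lpNorm p μ) := by
  refine ⟨fun u hu => hu.1, ⟨1, fun u _ => ?_⟩, fun u hu ⟨C, hC⟩ => ?_⟩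
  · rw [ENNReal.coe_one, one_mul]; exact le_self_add
  · obtain ⟨K, hK, huK⟩ := exists_lintegral_bound_of_lpNorm_le hp
      fun n => le_self_add.trans (hC n)
    obtain ⟨K', hK', hgrad⟩ := hS u C fun n => le_add_self.trans (hC n)
    exact exists_subseq_tendsto_lpNorm hμ hp hdom (fun n => (hu n).1.1) hK huK
      (hgrad.smallIncrements hp hs hK')

end Compactness

end VarExp

theorem mainTheorem5 {X : Type*} [MetricSpace X] [MeasurableSpace X] [BorelSpace X]
    (μ : Measure X) (hμ : VarExp.BallsPosFinite μ)
    (p s q : X → ℝ≥0∞)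
    (hp : VarExp.IsBoundedExponent p μ) (hs : VarExp.IsBoundedExponent s μ)
    (hq : VarExp.IsExponent q μ)
    (h : TotallyBounded (Set.univ : Set X) ∨
      (VarExp.IsIntegrableMeasure μ ∧ VarExp.IsLogExponent p μ)) :
    VarExp.CompactlyEmbedded
        (VarExp.TLSpace s p q μ) (VarExp.tlNorm s p q μ)
        (VarExp.LpSpace p μ) (VarExp.lpNorm p μ) ∧
      VarExp.CompactlyEmbedded
        (VarExp.BesovSpace s p q μ) (VarExp.besovNorm s p q μ)
        (VarExp.LpSpace p μ) (VarExp.lpNorm p μ) := by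
  have hdom : VarExp.LocallyDominated p μ := by
    rcases h with h | ⟨h1, h2⟩
    · exact VarExp.locallyDominated_of_totallyBounded hμ hp h
    · have := hμ.secondCountableTopology
      exact VarExp.locallyDominated_of_integrable hμ h1 h2
  exact ⟨VarExp.compactlyEmbedded_of_gradientBound hμ hp hs hdom fun _ _ =>
      VarExp.exists_gradientBound_of_tlSeminorm_le hp hq,
    VarExp.compactlyEmbedded_of_gradientBound hμ hp hs hdom fun _ _ =>
      VarExp.exists_gradientBound_of_besovSeminorm_le hp hq⟩
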